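/- Let $\alpha\in\mathbb{C}\setminus\{0,-1,-2,\ldots\}$ and let $n\ge 1$ be an integer. **Notation.** For $f$ analytic near $0$, $f(x)=\sum_k f_kx^k$, let $\mathcal J_{\alpha}f(x)=\sum_k \frac{f_k}{k+\alpha}x^k$. For $\xi>0$ such that $f$ is analytic on $|x|\le \xi$ the Hadamard finite part of $\int_0^\xi t^{\alpha}f(t)\,dt$ is $\xi^{\alpha+1}\mathcal J_{\alpha+1}f(\xi)$, and $$\mathrm{f.p.}\!\int_0^\infty t^\alpha f(t)\,dt=\xi^{\alpha+1}\mathcal J_{\alpha+1}f(\xi)+\int_\xi^\infty t^\alpha f(t)\,dt ,$$ which does not depend on $\xi$. For a polynomial $p$ and $z\in\mathbb{C}\setminus[0,\infty)$ put $$\mathcal C_\alpha[p](z)=\frac1{2\pi i}\,\mathrm{f.p.}\!\int_0^\infty\frac{t^\alpha p(t)e^{-t}}{t-z}\,dt .$$ Let $L_m^{(\alpha)}(x)=w(x)^{-1}\frac{d^m}{dx^m}\left[x^mw(x)\right]$ with $w(x)=x^\alpha e^{-x}$, $x>0$ (a polynomial of degree $m$ with leading coefficient $(-1)^m$), and let $\pi_m=(-1)^mL_m^{(\alpha)}$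 be the monic Laguerre polynomials. Put $c_n=-2\pi i\,\left[(n-1)!\,\Gamma(\alpha+n)\right]^{-1}$. For $z\in\mathbb{C}\setminus[0,\infty)$ the power $z^\alpha$ is taken with $0<\arg z<2\pi$. We write $g(z)=z^\alpha\mathcal O_0+O(1)$ as $z\to0$ if there is a function $g_0$ analytic at $0$ with $g(z)-z^\alpha g_0(z)=O(1)$ as $z\to 0$. **Theorem.** The following Riemann–Hilbert problem for a function $Y$ on $\mathbb{C}\setminus[0,\infty)$ with values in the complex $2\times2$ matrices: (I) $Y$ is analytic on $\mathbb{C}\setminus[0,\infty)$, and for every $x>0$ the limits $Y^{+}(x)=\lim_{z\to x,\ \operatorname{Im} z>0}Y(z)$ and $Y^{-}(x)=\lim_{z\to x,\ \operatorname{Im} z<0}Y(z)$ exist; (II) $Y^+(x)=Y^-(x)\begin{pmatrix}1&x^\alpha e^{-x}\\0&1\end{pmatrix}$ for $x>0$; (III$_\infty$) $Y(z)=\left(I+O(z^{-1})\right)\begin{pmatrix}z^n&0\\0&z^{-n}\end{pmatrix}$ as $z\to\infty$ in $\mathbb{C}\setminus[0,\infty)$; (III$_0$) $Y(z)=\begin{pmatrix}O(1)&z^\alpha\mathcal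 O_0+O(1)\\O(1)&z^\alpha\mathcal O_0+O(1)\end{pmatrix}$ as $z\to0$ in $\mathbb{C}\setminus[0,\infty)$; has the unique solution $$Y=\begin{pmatrix}\pi_n&\mathcal C_\alpha[\pi_n]\\ c_n\pi_{n-1}&c_n\mathcal C_\alpha[\pi_{n-1}]\end{pmatrix}.$$ -/

import Mathlib

open Complex Filter Topology MeasureTheory Polynomial

noncomputable section

namespace LaguerreRH

/-! ### The Hadamard finite part -/

/-- The operator `𝒥_α`: if `f(x) = ∑ fₙ xⁿ` near `0`, then `𝒥_α f (x) = ∑ fₙ / (n + α) xⁿ`. -/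
def opJ (α : ℂ) (f : ℂ → ℂ) (x : ℂ) : ℂ :=
  ∑' n : ℕ, (iteratedDeriv n f 0 / (n.factorial : ℂ)) / ((n : ℂ) + α) * x ^ n

/-- The Hadamard finite part of `∫₀ˣ t^(α-1) f(t) dt` for `x > 0`, namely `x^α 𝒥_α f (x)`. -/
def finitePartTo (α : ℂ) (f : ℂ → ℂ) (x : ℝ) : ℂ :=
  (x : ℂ) ^ α * opJ α f x

open Classical in
/-- The Hadamard finite part of `∫₀^∞ t^α f(t) dt`: the finite part over `(0, ξ)` plus the ordinary
integral over `(ξ, ∞)`, for any `ξ > 0` such that `f` is analytic on the closed disk of radius `ξ`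
centred at `0`. The choice of `ξ` is immaterial, see `finitePart_eq`. -/
def finitePart (α : ℂ) (f : ℂ → ℂ) : ℂ :=
  if h : ∃ ξ : ℝ, 0 < ξ ∧ AnalyticOnNhd ℂ f (Metric.closedBall 0 ξ) then
    finitePartTo (α + 1) f h.choose + ∫ t in Set.Ioi h.choose, (t : ℂ) ^ α * f t
  else 0

/-- The Taylor series at `0` converges up to the boundary of a closed disk of analyticity. -/
lemma hasSum_taylor {f : ℂ → ℂ} {ξ : ℝ} (hξ : 0 < ξ)
    (hf : AnalyticOnNhd ℂ f (Metric.closedBall 0 ξ)) {z : ℂ} (hz : ‖z‖ ≤ ξ) :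
    HasSum (fun n : ℕ => iteratedDeriv n f 0 / (n.factorial : ℂ) * z ^ n) (f z) := by
  obtain ⟨δ, hδ, hsub⟩ := (isCompact_closedBall (0 : ℂ) ξ).exists_thickening_subset_open
    (isOpen_analyticAt ℂ f) (fun x hx => hf x hx)
  have hb : Metric.ball (0 : ℂ) (δ + ξ) ⊆ {x | AnalyticAt ℂ f x} := by
    rw [thickening_closedBall hδ hξ.le] at hsub
    exact hsub
  have hd : DifferentiableOn ℂ f (Metric.ball 0 (δ + ξ)) :=
    fun x hx => (hb hx).differentiableAt.differentiableWithinAt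
  have hzm : z ∈ Metric.ball (0 : ℂ) (δ + ξ) := by
    rw [mem_ball_zero_iff]; linarith
  have h := Complex.hasSum_taylorSeries_on_ball (r := δ + ξ) hd hzm
  refine h.congr_fun fun n => ?_
  simp only [sub_zero, smul_eq_mul]
  ring

/-- Additivity over intervals of the finite part. -/
lemma finitePartTo_sub {α : ℂ} (hα : ∀ k : ℕ, (k : ℂ) + α ≠ 0) {f : ℂ → ℂ} {a b ξ : ℝ}
    (ha : 0 < a) (hab : a ≤ b) (hb : b ≤ ξ)
    (hf : AnalyticOnNhd ℂ f (Metric.closedBall 0 ξ)) :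
    ∫ t in a..b, (t : ℂ) ^ (α - 1) * f t = finitePartTo α f b - finitePartTo α f a := by
  have hξ : 0 < ξ := by linarith
  have hb0 : 0 < b := by linarith
  set c : ℕ → ℂ := fun n => iteratedDeriv n f 0 / (n.factorial : ℂ) with hc
  have hsum : ∀ x : ℝ, 0 < x → x ≤ ξ → HasSum (fun n => c n * (x : ℂ) ^ n) (f x) := by
    intro x hx hxξ
    refine hasSum_taylor hξ hf ?_
    rw [Complex.norm_real, Real.norm_eq_abs, abs_of_pos hx]
    exact hxξ
  have h0 : (0 : ℝ) ∉ Set.uIcc a b := by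
    rw [Set.uIcc_of_le hab]
    exact fun h => absurd h.1 (by linarith)
  have hpow : ∀ (n : ℕ) (x : ℝ), 0 < x →
      (x : ℂ) ^ (α - 1) * (x : ℂ) ^ n = (x : ℂ) ^ ((n : ℂ) + α - 1) := by
    intro n x hx
    have hx' : (x : ℂ) ≠ 0 := by exact_mod_cast hx.ne'
    rw [← cpow_natCast, ← cpow_add _ _ hx']
    congr 1
    ring
  have hcont : ∀ r : ℂ, ContinuousOn (fun t : ℝ => (t : ℂ) ^ r) (Set.uIcc a b) := by
    intro r t ht
    rw [Set.uIcc_of_le hab] at ht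
    refine (ContinuousAt.cpow (by fun_prop) continuousAt_const ?_).continuousWithinAt
    left
    simpa using lt_of_lt_of_le ha ht.1
  have hInt : ∀ n : ℕ, ∫ t in a..b, c n * (t : ℂ) ^ ((n : ℂ) + α - 1) =
      c n * (((b : ℂ) ^ ((n : ℂ) + α) - (a : ℂ) ^ ((n : ℂ) + α)) / ((n : ℂ) + α)) := by
    intro n
    rw [intervalIntegral.integral_const_mul, integral_cpow]
    · simp
    · right
      refine ⟨fun h => hα n ?_, h0⟩
      linear_combination h
  have hsn : Summable fun n => ‖c n * (b : ℂ) ^ n‖ := (hsum b hb0 hb).summable.norm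
  have h1 : HasSum (fun n : ℕ => ∫ t in a..b, c n * (t : ℂ) ^ ((n : ℂ) + α - 1))
      (∫ t in a..b, (t : ℂ) ^ (α - 1) * f t) := by
    refine intervalIntegral.hasSum_integral_of_dominated_convergence
      (fun n t => ‖c n * (b : ℂ) ^ n‖ * ‖(t : ℂ) ^ (α - 1)‖) ?_ ?_ ?_ ?_ ?_
    · intro n
      refine ContinuousOn.aestronglyMeasurable ?_ measurableSet_uIoc
      exact (continuousOn_const.mul (hcont _)).mono Set.uIoc_subset_uIcc
    · intro n
      filter_upwards with t ht
      rw [Set.uIoc_of_le hab] at ht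
      have ht0 : 0 < t := lt_trans ha ht.1
      rw [← hpow n t ht0, norm_mul, norm_mul, norm_mul, norm_pow, norm_pow, Complex.norm_real,
        Complex.norm_real, Real.norm_eq_abs, Real.norm_eq_abs, abs_of_pos ht0, abs_of_pos hb0]
      have h3 : t ^ n ≤ b ^ n := pow_le_pow_left₀ ht0.le ht.2 n
      calc ‖c n‖ * (‖(t : ℂ) ^ (α - 1)‖ * t ^ n) ≤ ‖c n‖ * (‖(t : ℂ) ^ (α - 1)‖ * b ^ n) := by
            gcongr
        _ = _ := by ring
    · filter_upwards with t _
      exact hsn.mul_right _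
    · simp_rw [tsum_mul_right]
      exact ((continuousOn_const.mul (hcont _).norm)).intervalIntegrable
    · filter_upwards with t ht
      rw [Set.uIoc_of_le hab] at ht
      have ht0 : 0 < t := lt_trans ha ht.1
      have h4 := (hsum t ht0 (ht.2.trans hb)).mul_left ((t : ℂ) ^ (α - 1))
      refine h4.congr_fun fun n => ?_
      rw [← hpow n t ht0]
      ring
  have hS : ∀ x : ℝ, 0 < x → x ≤ ξ →
      HasSum (fun n : ℕ => c n * ((x : ℂ) ^ ((n : ℂ) + α) / ((n : ℂ) + α)))
        (finitePartTo α f x) := by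
    intro x hx hxξ
    have hx' : (x : ℂ) ≠ 0 := by exact_mod_cast hx.ne'
    have hs : Summable fun n : ℕ => c n / ((n : ℂ) + α) * (x : ℂ) ^ n := by
      have htend : Tendsto (fun n : ℕ => ‖(n : ℂ) + α‖) atTop atTop := by
        refine tendsto_atTop_mono (f := fun n : ℕ => (n : ℝ) + -‖α‖) (fun n => ?_)
          (tendsto_atTop_add_const_right _ _ tendsto_natCast_atTop_atTop)
        have h6 := norm_sub_norm_le (n : ℂ) (-α)
        rw [sub_neg_eq_add, norm_neg, Complex.norm_natCast] at h6
        linarith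
      refine Summable.of_norm_bounded_eventually_nat (hsum x hx hxξ).summable.norm ?_
      filter_upwards [htend.eventually_ge_atTop 1] with n hn
      rw [norm_mul, norm_mul, norm_div]
      gcongr
      exact div_le_self (norm_nonneg _) hn
    have h5 := hs.hasSum.mul_left ((x : ℂ) ^ α)
    refine HasSum.congr_fun h5 fun n => ?_
    rw [cpow_add _ _ hx', cpow_natCast]
    ring
  refine h1.unique ?_
  simp_rw [hInt]
  refine ((hS b hb0 hb).sub (hS a ha (hab.trans hb))).congr_fun fun n => ?_
  ring

/-- The finite part does not depend on the choice of the splitting point `ξ`. -/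
theorem finitePart_eq {α : ℂ} (hα : ∀ k : ℕ, α ≠ -((k : ℂ) + 1)) {f : ℂ → ℂ} {ξ : ℝ}
    (hξ : 0 < ξ) (hf : AnalyticOnNhd ℂ f (Metric.closedBall 0 ξ))
    (hint : IntegrableOn (fun t : ℝ => (t : ℂ) ^ α * f t) (Set.Ioi ξ)) :
    finitePart α f = finitePartTo (α + 1) f ξ + ∫ t in Set.Ioi ξ, (t : ℂ) ^ α * f t := by
  have hα' : ∀ k : ℕ, (k : ℂ) + (α + 1) ≠ 0 := fun k h => hα k (by linear_combination h)
  have key : ∀ a b : ℝ, 0 < a → a ≤ b → AnalyticOnNhd ℂ f (Metric.closedBall 0 b) →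
      IntegrableOn (fun t : ℝ => (t : ℂ) ^ α * f t) (Set.Ioi b) →
      finitePartTo (α + 1) f a + ∫ t in Set.Ioi a, (t : ℂ) ^ α * f t =
        finitePartTo (α + 1) f b + ∫ t in Set.Ioi b, (t : ℂ) ^ α * f t := by
    intro a b ha hab hfb hib
    have h1 := finitePartTo_sub hα' ha hab le_rfl hfb
    rw [add_sub_cancel_right] at h1
    have hii : IntervalIntegrable (fun t : ℝ => (t : ℂ) ^ α * f t) volume a b := by
      refine ContinuousOn.intervalIntegrable ?_
      intro t ht
      rw [Set.uIcc_of_le hab] at ht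
      have ht0 : 0 < t := lt_of_lt_of_le ha ht.1
      have hft : ContinuousAt f (t : ℂ) := by
        refine (hfb (t : ℂ) ?_).continuousAt
        rw [mem_closedBall_zero_iff, Complex.norm_real, Real.norm_eq_abs, abs_of_pos ht0]
        exact ht.2
      refine (ContinuousAt.mul (ContinuousAt.cpow (by fun_prop) continuousAt_const ?_)
        (hft.comp (f := fun t : ℝ => (t : ℂ)) (by fun_prop))).continuousWithinAt
      left
      simpa using ht0
    have hia : IntegrableOn (fun t : ℝ => (t : ℂ) ^ α * f t) (Set.Ioi a) := by
      rw [← Set.Ioc_union_Ioi_eq_Ioi hab]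
      exact ((intervalIntegrable_iff_integrableOn_Ioc_of_le hab).1 hii).union hib
    have h2 := intervalIntegral.integral_Ioi_sub_Ioi hia hab
    rw [h1] at h2
    linear_combination h2
  have h : ∃ ξ : ℝ, 0 < ξ ∧ AnalyticOnNhd ℂ f (Metric.closedBall 0 ξ) := ⟨ξ, hξ, hf⟩
  rw [finitePart, dif_pos h]
  obtain ⟨hη, hfη⟩ := h.choose_spec
  generalize h.choose = η at hη hfη
  rcases le_total η ξ with hle | hle
  · exact key η ξ hη hle hf hint
  · exact (key ξ η hξ hle hfη (hint.mono_set (Set.Ioi_subset_Ioi hle))).symm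

/-- The finite-part Cauchy transform
`𝒞_α[p](z) = (2πi)⁻¹ f.p. ∫₀^∞ t^α p(t) e^(-t) / (t - z) dt`. -/
def cauchyTransform (α : ℂ) (p : ℂ[X]) (z : ℂ) : ℂ :=
  (2 * Real.pi * I)⁻¹ * finitePart α (fun t => p.eval t * exp (-t) / (t - z))

/-! ### Laguerre polynomials with general parameter -/

/-- The weight `w(x) = x^α e^(-x)` on `(0, ∞)`. -/
def weight (α : ℂ) (x : ℝ) : ℂ := (x : ℂ) ^ α * exp (-(x : ℂ))

/-- `laguerreAux α n k = 𝒜_{n-k+1} ⋯ 𝒜_n 1`, where `𝒜_j P = (j + α - x) P + x P'`. -/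
def laguerreAux (α : ℂ) (n : ℕ) : ℕ → ℂ[X]
  | 0 => 1
  | k + 1 => (C (((n : ℂ) - k) + α) - X) * laguerreAux α n k + X * derivative (laguerreAux α n k)

/-- The Laguerre polynomial `L_n^{(α)}(x) = w(x)⁻¹ (d/dx)ⁿ [xⁿ w(x)]` (without the factor `1/n!`),
as a polynomial with complex coefficients; Rodrigues' formula is `laguerre_rodrigues`. -/
def laguerre (α : ℂ) (n : ℕ) : ℂ[X] := laguerreAux α n n

lemma iteratedDeriv_laguerreAux (α : ℂ) (n k : ℕ) (hk : k ≤ n) {x : ℝ} (hx : 0 < x) :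
    iteratedDeriv k (fun t : ℝ => (t : ℂ) ^ n * weight α t) x =
      (x : ℂ) ^ (n - k) * weight α x * (laguerreAux α n k).eval (x : ℂ) := by
  induction k generalizing x with
  | zero => simp [laguerreAux]
  | succ k ih =>
    have hx' : (x : ℂ) ≠ 0 := by exact_mod_cast hx.ne'
    rw [iteratedDeriv_succ]
    have hev : iteratedDeriv k (fun t : ℝ => (t : ℂ) ^ n * weight α t) =ᶠ[𝓝 x]
        fun t : ℝ => (t : ℂ) ^ (n - k) * weight α t * (laguerreAux α n k).eval (t : ℂ) := by
      filter_upwards [lt_mem_nhds hx] with t ht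
      exact ih (by omega) ht
    rw [hev.deriv_eq]
    obtain ⟨m, hm⟩ : ∃ m, n - k = m + 1 := ⟨n - k - 1, by omega⟩
    have hm' : n - (k + 1) = m := by omega
    have hnm : (n : ℂ) - k = (m : ℂ) + 1 := by
      have h7 : n = m + 1 + k := by omega
      rw [h7]
      push_cast
      ring
    rw [hm, hm', laguerreAux, hnm]
    have hd : HasDerivAt (fun z : ℂ => z ^ (m + 1) * (z ^ α * exp (-z)) *
        (laguerreAux α n k).eval z)
        ((((m + 1 : ℕ) : ℂ) * (x : ℂ) ^ m * ((x : ℂ) ^ α * exp (-(x : ℂ))) + (x : ℂ) ^ (m + 1) *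
          ((α * (x : ℂ) ^ (α - 1) * 1) * exp (-(x : ℂ)) +
            (x : ℂ) ^ α * (exp (-(x : ℂ)) * (-1)))) * (laguerreAux α n k).eval (x : ℂ) +
          (x : ℂ) ^ (m + 1) * ((x : ℂ) ^ α * exp (-(x : ℂ))) *
            (derivative (laguerreAux α n k)).eval (x : ℂ)) (x : ℂ) := by
      refine HasDerivAt.mul (HasDerivAt.mul (hasDerivAt_pow (m + 1) _) (HasDerivAt.mul ?_ ?_))
        (Polynomial.hasDerivAt _ _)
      · exact (hasDerivAt_id (x : ℂ)).cpow_const (by left; simpa using hx)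
      · exact (hasDerivAt_neg (x : ℂ)).cexp
    refine (hd.comp_ofReal).deriv.trans ?_
    rw [cpow_sub _ _ hx', cpow_one, weight]
    simp only [eval_add, eval_mul, eval_sub, eval_C, eval_X]
    field_simp
    push_cast
    ring

/-- Rodrigues' formula; it determines the polynomial `laguerre α n`. -/
theorem laguerre_rodrigues (α : ℂ) (n : ℕ) {x : ℝ} (hx : 0 < x) :
    (laguerre α n).eval (x : ℂ) =
      (weight α x)⁻¹ * iteratedDeriv n (fun t : ℝ => (t : ℂ) ^ n * weight α t) x := by
  have hw : weight α x ≠ 0 := by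
    unfold weight
    refine mul_ne_zero ?_ (exp_ne_zero _)
    rw [Ne, cpow_eq_zero_iff]
    simp [hx.ne']
  rw [iteratedDeriv_laguerreAux α n n le_rfl hx, laguerre]
  field_simp
  simp

/-- The monic Laguerre polynomial `π_n = (-1)ⁿ L_n^{(α)}`. -/
def monicLaguerre (α : ℂ) (n : ℕ) : ℂ[X] := C ((-1) ^ n) * laguerre α n

/-! ### The Riemann–Hilbert problem -/

/-- The slit plane `ℂ ∖ [0, ∞)`. -/
def cutPlane : Set ℂ := {z | ¬ (0 ≤ z.re ∧ z.im = 0)}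

/-- The branch of `z^α` on `ℂ ∖ [0, ∞)` given by `0 < arg z < 2π`; there
`log (-z) + π i = log |z| + i arg z`. -/
def cutPow (α z : ℂ) : ℂ := exp (α * (log (-z) + Real.pi * I))

/-- `f(z) = z^α 𝒪₀ + O(1)` as `z → 0` in `ℂ ∖ [0, ∞)`. -/
def IsPowGermAddBounded (α : ℂ) (f : ℂ → ℂ) : Prop :=
  ∃ f₀ : ℂ → ℂ, AnalyticAt ℂ f₀ 0 ∧
    (fun z => f z - cutPow α z * f₀ z) =O[𝓝[cutPlane] 0] (fun _ => (1 : ℂ))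

/-- `Y` (of which only the values on `ℂ ∖ [0, ∞)` matter) solves the Riemann–Hilbert problem. -/
structure IsSolution (α : ℂ) (n : ℕ) (Y : ℂ → Matrix (Fin 2) (Fin 2) ℂ) : Prop where
  analytic : ∀ i j, AnalyticOnNhd ℂ (fun z => Y z i j) cutPlane
  /-- The boundary values from the two sides exist, and they satisfy the jump relation. -/
  jump : ∃ Yp Ym : ℝ → Matrix (Fin 2) (Fin 2) ℂ, ∀ x : ℝ, 0 < x →
    Tendsto Y (𝓝[{z | 0 < z.im}] (x : ℂ)) (𝓝 (Yp x)) ∧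
    Tendsto Y (𝓝[{z | z.im < 0}] (x : ℂ)) (𝓝 (Ym x)) ∧
    Yp x = Ym x * !![1, weight α x; 0, 1]
  /-- `Y(z) = (I + O(1/z)) diag(zⁿ, z⁻ⁿ)` as `z → ∞`. -/
  infty : ∃ E : ℂ → Matrix (Fin 2) (Fin 2) ℂ,
    (∀ i j, (fun z => E z i j) =O[Bornology.cobounded ℂ ⊓ 𝓟 cutPlane] (fun z => z⁻¹)) ∧
    ∀ᶠ z in Bornology.cobounded ℂ ⊓ 𝓟 cutPlane,
      Y z = (1 + E z) * !![z ^ n, 0; 0, (z ^ n)⁻¹]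
  zero_left : ∀ i, (fun z => Y z i 0) =O[𝓝[cutPlane] 0] (fun _ => (1 : ℂ))
  zero_right : ∀ i, IsPowGermAddBounded α (fun z => Y z i 1)

/-- The constant `c_n = -2πi / ((n-1)! Γ(α+n))`, used for `n ≥ 1`. -/
def coeffC (α : ℂ) (n : ℕ) : ℂ :=
  -2 * Real.pi * I * (((n - 1).factorial : ℂ) * Complex.Gamma (α + n))⁻¹

/-- The matrix built from `π_n`, `π_{n-1}` and their finite-part Cauchy transforms, for `n ≥ 1`. -/
def solution (α : ℂ) (n : ℕ) (z : ℂ) : Matrix (Fin 2) (Fin 2) ℂ :=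
  !![(monicLaguerre α n).eval z, cauchyTransform α (monicLaguerre α n) z;
     coeffC α n * (monicLaguerre α (n - 1)).eval z,
     coeffC α n * cauchyTransform α (monicLaguerre α (n - 1)) z]

end LaguerreRH

end

open Complex Filter Topology MeasureTheory Polynomial

noncomputable section

namespace LaguerreRH

/-! ### Rules of calculation for the finite part -/

/-! Existence rests on the scalar functions G_β(z) = f.p. ∫₀^∞ t^β e^(-t)/(t - z) dt
(`expTransform`), because the Cauchy transform of a polynomial is a linear combination of the
G_{α+i}. The identity z/(t - z) = t/(t - z) - 1 gives z G_β = G_{β+1} - Γ(β+1) (`mul_expTransform`).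
Hence whatever is known for large Re β, where the finite part is an honest integral, descends to
every β that is not a negative integer.

In this way G_β satisfies z(G' + G) = βG - Γ(β+1), so e^z G_β is a multiple of z^β plus an entire
function, with an extra -z^m log(-z) when β = m is a natural number. This explicit form gives the
boundary values on the cut and the behaviour z^α 𝒪₀ + O(1) at the origin; for α = 0 a bare logarithm
would remain. The jump 2πi w(x) comes from the Poisson kernel, and G_β = O(1/z) from an estimate
uniform up to the cut. The condition at infinity is then orthogonality: the finite-part moments of
t^j π_m vanish for j < m, which allows z^n to be moved inside the Cauchy transform, and c_n
normalises the first non-vanishing moment.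

For uniqueness, let Y and S be solutions. The jump matrix is unipotent, so the first columns have no
jump and are entire. The entries of Y S⁻¹ are, up to sign, the minors Y_{i0} S_{k1} - Y_{i1} S_{k0}.
They have no jump, and at the origin they are again of type z^α 𝒪₀ + O(1), since second-column
entries are multiplied only by entire functions. Morera's theorem removes the cut. A pole at 0 would
force some z^{α+k} with k a natural number to have a nonzero limit, impossible since α + k ≠ 0; so
the minors are entire, and Liouville's theorem makes them constant. -/

lemma taylorCoeff_eq {f : ℂ → ℂ} {c : ℕ → ℂ}
    (h : ∀ᶠ z in 𝓝 (0 : ℂ), HasSum (fun n => c n * z ^ n) (f z)) (n : ℕ) :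
    iteratedDeriv n f 0 / (n.factorial : ℂ) = c n := by
  have h1 : HasFPowerSeriesAt f (FormalMultilinearSeries.ofScalars ℂ c) 0 := by
    rw [hasFPowerSeriesAt_iff]
    filter_upwards [h] with z hz
    simpa [mul_comm] using hz
  have h2 := h1.analyticAt.hasFPowerSeriesAt
  have h3 := h1.eq_formalMultilinearSeries h2
  have h4 := congrArg (fun p => p.coeff n) h3
  simpa using h4.symm

lemma eventually_hasSum {f : ℂ → ℂ} {c : ℕ → ℂ} {ξ : ℝ} (hξ : 0 < ξ)
    (h : ∀ z : ℂ, ‖z‖ ≤ ξ → HasSum (fun n => c n * z ^ n) (f z)) :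
    ∀ᶠ z in 𝓝 (0 : ℂ), HasSum (fun n => c n * z ^ n) (f z) := by
  filter_upwards [Metric.closedBall_mem_nhds (0 : ℂ) hξ] with z hz
  exact h z (by simpa using hz)

lemma tendsto_norm_natCast_add_atTop (α : ℂ) :
    Tendsto (fun n : ℕ => ‖(n : ℂ) + α‖) atTop atTop := by
  refine tendsto_atTop_mono (f := fun n : ℕ => (n : ℝ) + -‖α‖) (fun n => ?_)
    (tendsto_atTop_add_const_right _ _ tendsto_natCast_atTop_atTop)
  have h6 := norm_sub_norm_le (n : ℂ) (-α)
  rw [sub_neg_eq_add, norm_neg, Complex.norm_natCast] at h6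
  linarith

lemma summable_norm_div_natCast_add {c : ℕ → ℂ} (α : ℂ) (h : Summable c) :
    Summable fun n : ℕ => ‖c n / ((n : ℂ) + α)‖ := by
  refine Summable.of_norm_bounded_eventually_nat h.norm ?_
  filter_upwards [(tendsto_norm_natCast_add_atTop α).eventually_ge_atTop 1] with n hn
  rw [norm_norm, norm_div]
  exact div_le_self (norm_nonneg _) hn

/-- Power series coefficients are unique, so any known expansion may replace the Taylor series in
`opJ`. Convergence survives the division because |n + α| → ∞. -/
lemma hasSum_opJ {f : ℂ → ℂ} {c : ℕ → ℂ} {ξ : ℝ} (hξ : 0 < ξ)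
    (h : ∀ z : ℂ, ‖z‖ ≤ ξ → HasSum (fun n => c n * z ^ n) (f z)) (α : ℂ) {z : ℂ} (hz : ‖z‖ ≤ ξ) :
    HasSum (fun n : ℕ => c n * z ^ n / ((n : ℂ) + α)) (opJ α f z) := by
  have h1 : opJ α f z = ∑' n : ℕ, c n * z ^ n / ((n : ℂ) + α) := by
    unfold opJ
    refine tsum_congr fun n => ?_
    rw [taylorCoeff_eq (eventually_hasSum hξ h)]
    ring
  rw [h1]
  exact (summable_norm_div_natCast_add α (h z hz).summable).of_norm.hasSum

lemma hasSum_finitePartTo {f : ℂ → ℂ} {c : ℕ → ℂ} {ξ : ℝ} (hξ : 0 < ξ)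
    (h : ∀ z : ℂ, ‖z‖ ≤ ξ → HasSum (fun n => c n * z ^ n) (f z)) (α : ℂ) :
    HasSum (fun n : ℕ => (ξ : ℂ) ^ α * (c n * (ξ : ℂ) ^ n / ((n : ℂ) + α)))
      (finitePartTo α f ξ) :=
  (hasSum_opJ hξ h α (by simp [abs_of_pos hξ])).mul_left _

lemma finitePartTo_add {α : ℂ} {f g : ℂ → ℂ} {ξ : ℝ} (hξ : 0 < ξ)
    (hf : AnalyticOnNhd ℂ f (Metric.closedBall 0 ξ))
    (hg : AnalyticOnNhd ℂ g (Metric.closedBall 0 ξ)) :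
    finitePartTo α (fun t => f t + g t) ξ = finitePartTo α f ξ + finitePartTo α g ξ := by
  have hF := fun z hz => hasSum_taylor (z := z) hξ hf hz
  have hG := fun z hz => hasSum_taylor (z := z) hξ hg hz
  have hFG : ∀ z : ℂ, ‖z‖ ≤ ξ → HasSum (fun n : ℕ => (iteratedDeriv n f 0 / (n.factorial : ℂ) +
      iteratedDeriv n g 0 / (n.factorial : ℂ)) * z ^ n) (f z + g z) := fun z hz =>
    ((hF z hz).add (hG z hz)).congr_fun fun n => by ring
  refine (hasSum_finitePartTo hξ hFG α).unique ?_
  refine ((hasSum_finitePartTo hξ hF α).add (hasSum_finitePartTo hξ hG α)).congr_fun fun n => ?_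
  ring

lemma finitePartTo_const_mul {α : ℂ} (b : ℂ) {f : ℂ → ℂ} {ξ : ℝ} (hξ : 0 < ξ)
    (hf : AnalyticOnNhd ℂ f (Metric.closedBall 0 ξ)) :
    finitePartTo α (fun t => b * f t) ξ = b * finitePartTo α f ξ := by
  have hF := fun z hz => hasSum_taylor (z := z) hξ hf hz
  have hb : ∀ z : ℂ, ‖z‖ ≤ ξ → HasSum (fun n : ℕ => (b * (iteratedDeriv n f 0 /
      (n.factorial : ℂ))) * z ^ n) (b * f z) := fun z hz =>
    ((hF z hz).mul_left b).congr_fun fun n => by ring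
  refine (hasSum_finitePartTo hξ hb α).unique ?_
  refine ((hasSum_finitePartTo hξ hF α).mul_left b).congr_fun fun n => ?_
  ring

/-- Shifting the coefficients by one turns the denominator n + α into (n + 1) + α = n + (α + 1); the
spare factor ξ raises the power in front. -/
lemma finitePartTo_id_mul {α : ℂ} {f : ℂ → ℂ} {ξ : ℝ} (hξ : 0 < ξ)
    (hf : AnalyticOnNhd ℂ f (Metric.closedBall 0 ξ)) :
    finitePartTo α (fun t => t * f t) ξ = finitePartTo (α + 1) f ξ := by
  have hξ' : (ξ : ℂ) ≠ 0 := by exact_mod_cast hξ.ne'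
  have hF := fun z hz => hasSum_taylor (z := z) hξ hf hz
  have h1 : ∀ z : ℂ, ‖z‖ ≤ ξ → HasSum (fun n : ℕ => (match n with
      | 0 => 0
      | n + 1 => iteratedDeriv n f 0 / (n.factorial : ℂ)) * z ^ n) (z * f z) := fun z hz => by
    rw [← hasSum_nat_add_iff' 1]
    simp only [Finset.range_one, Finset.sum_singleton, zero_mul, sub_zero]
    exact ((hF z hz).mul_left z).congr_fun fun n => by ring
  refine (hasSum_finitePartTo hξ h1 α).unique ?_
  rw [← hasSum_nat_add_iff' 1]
  simp only [Finset.range_one, Finset.sum_singleton, zero_mul, zero_div, mul_zero, sub_zero]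
  refine (hasSum_finitePartTo hξ hF (α + 1)).congr_fun fun n => ?_
  rw [cpow_add _ _ hξ', cpow_one]
  push_cast
  ring

section

variable {β : ℂ} {f g : ℂ → ℂ} {ξ : ℝ}

lemma finitePart_congr (hβ : ∀ k : ℕ, β ≠ -((k : ℂ) + 1)) (hξ : 0 < ξ)
    (hf : AnalyticOnNhd ℂ f (Metric.closedBall 0 ξ))
    (hg : AnalyticOnNhd ℂ g (Metric.closedBall 0 ξ))
    (h : Set.EqOn f g (Metric.closedBall 0 ξ)) (h' : ∀ t ∈ Set.Ioi ξ, f (t : ℂ) = g t)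
    (hgi : IntegrableOn (fun t : ℝ => (t : ℂ) ^ β * g t) (Set.Ioi ξ)) :
    finitePart β f = finitePart β g := by
  have he : Set.EqOn (fun t : ℝ => (t : ℂ) ^ β * f t) (fun t : ℝ => (t : ℂ) ^ β * g t)
      (Set.Ioi ξ) := fun t ht => by
    simp only
    rw [h' t ht]
  have hG := fun z hz => hasSum_taylor (z := z) hξ hg hz
  have hF : ∀ z : ℂ, ‖z‖ ≤ ξ →
      HasSum (fun n : ℕ => iteratedDeriv n g 0 / (n.factorial : ℂ) * z ^ n) (f z) := by
    intro z hz
    rw [h (by simpa using hz)]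
    exact hG z hz
  rw [finitePart_eq hβ hξ hf (hgi.congr_fun he.symm measurableSet_Ioi),
    finitePart_eq hβ hξ hg hgi, setIntegral_congr_fun measurableSet_Ioi he,
    (hasSum_finitePartTo hξ hF (β + 1)).unique (hasSum_finitePartTo hξ hG (β + 1))]

lemma finitePart_add (hβ : ∀ k : ℕ, β ≠ -((k : ℂ) + 1)) (hξ : 0 < ξ)
    (hf : AnalyticOnNhd ℂ f (Metric.closedBall 0 ξ))
    (hg : AnalyticOnNhd ℂ g (Metric.closedBall 0 ξ))
    (hfi : IntegrableOn (fun t : ℝ => (t : ℂ) ^ β * f t) (Set.Ioi ξ))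
    (hgi : IntegrableOn (fun t : ℝ => (t : ℂ) ^ β * g t) (Set.Ioi ξ)) :
    finitePart β (fun t => f t + g t) = finitePart β f + finitePart β g := by
  have he : (fun t : ℝ => (t : ℂ) ^ β * (f t + g t)) =
      fun t : ℝ => (t : ℂ) ^ β * f t + (t : ℂ) ^ β * g t := by
    ext t; ring
  rw [finitePart_eq hβ hξ hf hfi, finitePart_eq hβ hξ hg hgi,
    finitePart_eq (f := fun t => f t + g t) hβ hξ (hf.add hg) (he ▸ hfi.add hgi),
    finitePartTo_add hξ hf hg, he,
    integral_add hfi hgi]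
  ring

lemma finitePart_const_mul (hβ : ∀ k : ℕ, β ≠ -((k : ℂ) + 1)) (b : ℂ) (hξ : 0 < ξ)
    (hf : AnalyticOnNhd ℂ f (Metric.closedBall 0 ξ))
    (hfi : IntegrableOn (fun t : ℝ => (t : ℂ) ^ β * f t) (Set.Ioi ξ)) :
    finitePart β (fun t => b * f t) = b * finitePart β f := by
  have he : (fun t : ℝ => (t : ℂ) ^ β * (b * f t)) = fun t : ℝ => b * ((t : ℂ) ^ β * f t) := by
    ext t; ring
  rw [finitePart_eq hβ hξ hf hfi,
    finitePart_eq hβ hξ (analyticOnNhd_const.mul hf) (he ▸ hfi.const_mul b),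
    finitePartTo_const_mul b hξ hf, he, integral_const_mul]
  ring

lemma cpow_add_one_ofReal {t : ℝ} (ht : 0 < t) (β : ℂ) :
    (t : ℂ) ^ (β + 1) = (t : ℂ) ^ β * t := by
  rw [cpow_add _ _ (by exact_mod_cast ht.ne'), cpow_one]

lemma finitePart_id_mul (hβ : ∀ k : ℕ, β ≠ -((k : ℂ) + 1)) (hξ : 0 < ξ)
    (hf : AnalyticOnNhd ℂ f (Metric.closedBall 0 ξ))
    (hfi : IntegrableOn (fun t : ℝ => (t : ℂ) ^ (β + 1) * f t) (Set.Ioi ξ)) :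
    finitePart β (fun t => t * f t) = finitePart (β + 1) f := by
  have he : Set.EqOn (fun t : ℝ => (t : ℂ) ^ β * (t * f t))
      (fun t : ℝ => (t : ℂ) ^ (β + 1) * f t) (Set.Ioi ξ) := by
    intro t ht
    simp only
    rw [cpow_add_one_ofReal (hξ.trans ht)]
    ring
  have hβ' : ∀ k : ℕ, β + 1 ≠ -((k : ℂ) + 1) := fun k h => hβ (k + 1) (by
    push_cast
    linear_combination h)
  rw [finitePart_eq hβ' hξ hf hfi, finitePart_eq hβ hξ (analyticOnNhd_id.mul hf)
    (hfi.congr_fun he.symm measurableSet_Ioi), setIntegral_congr_fun measurableSet_Ioi he,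
    ← finitePartTo_id_mul hξ hf]

lemma finitePart_eq_integral (hβ : -1 < β.re) (hξ : 0 < ξ)
    (hf : AnalyticOnNhd ℂ f (Metric.closedBall 0 ξ))
    (hfi : IntegrableOn (fun t : ℝ => (t : ℂ) ^ β * f t) (Set.Ioi 0)) :
    finitePart β f = ∫ t in Set.Ioi (0 : ℝ), (t : ℂ) ^ β * f t := by
  have hβ' : ∀ k : ℕ, β ≠ -((k : ℂ) + 1) := by
    intro k h
    have h1 := congrArg Complex.re h
    simp at h1
    have : (0 : ℝ) ≤ k := k.cast_nonneg
    linarith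
  -- The left side does not involve the splitting point a, while both terms on the right tend to 0
  -- with a, the first because it is at most a constant times a^(Re β + 1).
  have h1 : ∀ᶠ a : ℝ in 𝓝[>] 0, finitePart β f - ∫ t in Set.Ioi (0 : ℝ), (t : ℂ) ^ β * f t =
      finitePartTo (β + 1) f a - ∫ t in (0 : ℝ)..a, (t : ℂ) ^ β * f t := by
    filter_upwards [Ioo_mem_nhdsGT hξ] with a ha
    rw [finitePart_eq hβ' ha.1 (hf.mono (Metric.closedBall_subset_closedBall ha.2.le))
      (hfi.mono_set (Set.Ioi_subset_Ioi ha.1.le)),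
      ← intervalIntegral.integral_Ioi_sub_Ioi hfi ha.1.le]
    ring
  have h2 : Tendsto (fun a : ℝ => ∫ t in (0 : ℝ)..a, (t : ℂ) ^ β * f t) (𝓝[>] 0) (𝓝 0) := by
    have hi : IntegrableOn (fun t : ℝ => (t : ℂ) ^ β * f t) (Set.uIcc 0 ξ) := by
      rw [Set.uIcc_of_le hξ.le, integrableOn_Icc_iff_integrableOn_Ioc]
      exact hfi.mono_set Set.Ioc_subset_Ioi_self
    have h3 := intervalIntegral.continuousOn_primitive_interval hi 0 Set.left_mem_uIcc
    unfold ContinuousWithinAt at h3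
    beta_reduce at h3
    rw [intervalIntegral.integral_same, Set.uIcc_of_le hξ.le] at h3
    refine h3.mono_left ?_
    exact nhdsWithin_le_of_mem (Icc_mem_nhdsGT hξ)
  have h4 : Tendsto (fun a : ℝ => finitePartTo (β + 1) f a) (𝓝[>] 0) (𝓝 0) := by
    have hF := fun z hz => hasSum_taylor (z := z) hξ hf hz
    set c : ℕ → ℂ := fun n => iteratedDeriv n f 0 / (n.factorial : ℂ) with hc
    have hs := summable_norm_div_natCast_add (β + 1)
      (hF (ξ : ℂ) (by simp [abs_of_pos hξ])).summable
    set B := ∑' n : ℕ, ‖c n * (ξ : ℂ) ^ n / ((n : ℂ) + (β + 1))‖ with hB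
    have hbound : ∀ᶠ a : ℝ in 𝓝[>] 0, ‖finitePartTo (β + 1) f a‖ ≤ a ^ (β.re + 1) * B := by
      filter_upwards [Ioo_mem_nhdsGT hξ] with a ha
      have haξ : ‖(a : ℂ)‖ ≤ ξ := by simpa [abs_of_pos ha.1] using ha.2.le
      have h5 := hasSum_opJ hξ hF (β + 1) haξ
      have h6 : ‖opJ (β + 1) f a‖ ≤ B := by
        rw [← h5.tsum_eq]
        refine tsum_of_norm_bounded hs.hasSum fun n => ?_
        have : ‖(ξ : ℂ)‖ = ξ := by simp [abs_of_pos hξ]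
        simp only [norm_div, norm_mul, norm_pow, this]
        gcongr
      rw [finitePartTo, norm_mul, Complex.norm_cpow_eq_rpow_re_of_pos ha.1]
      simp only [add_re, one_re]
      exact mul_le_mul_of_nonneg_left h6 (Real.rpow_nonneg ha.1.le _)
    refine squeeze_zero_norm' hbound ?_
    have h7 : Tendsto (fun a : ℝ => a ^ (β.re + 1)) (𝓝[>] 0) (𝓝 0) := by
      have := (Real.continuousAt_rpow_const (0 : ℝ) (β.re + 1) (Or.inr (by linarith))).tendsto
      rw [Real.zero_rpow (by linarith)] at this
      exact this.mono_left nhdsWithin_le_nhds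
    simpa using h7.mul_const B
  have h8 := tendsto_nhds_unique (tendsto_const_nhds.congr' h1) (h4.sub h2)
  rw [sub_zero] at h8
  exact sub_eq_zero.1 h8

end

/-! ### The weight and the transform of the exponential -/

lemma continuousOn_weight (β : ℂ) : ContinuousOn (weight β) (Set.Ioi 0) := by
  intro t ht
  unfold weight
  refine (ContinuousAt.mul (ContinuousAt.cpow (by fun_prop) continuousAt_const ?_)
    (by fun_prop)).continuousWithinAt
  left
  simpa using ht

lemma norm_weight (β : ℂ) {t : ℝ} (ht : 0 < t) :
    ‖weight β t‖ = t ^ β.re * Real.exp (-t) := by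
  rw [weight, norm_mul, Complex.norm_cpow_eq_rpow_re_of_pos ht, Complex.norm_exp]
  simp

lemma weight_add_one (β : ℂ) {t : ℝ} (ht : 0 < t) : weight (β + 1) t = weight β t * t := by
  rw [weight, weight, cpow_add_one_ofReal ht]
  ring

lemma weight_add_natCast (β : ℂ) (i : ℕ) {t : ℝ} (ht : 0 < t) :
    weight (β + i) t = weight β t * (t : ℂ) ^ i := by
  rw [weight, weight, cpow_add _ _ (by exact_mod_cast ht.ne'), cpow_natCast]
  ring

lemma integrableOn_weight_Ioi (β : ℂ) {ξ : ℝ} (hξ : 0 < ξ) :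
    IntegrableOn (weight β) (Set.Ioi ξ) := by
  have hc : ContinuousOn (weight β) (Set.Ici ξ) :=
    (continuousOn_weight β).mono (Set.Ici_subset_Ioi.2 hξ)
  have hm := (hc.mono Set.Ioi_subset_Ici_self).aestronglyMeasurable (μ := volume) measurableSet_Ioi
  refine (integrable_norm_iff hm).1
    (integrable_of_isBigO_exp_neg (b := 1 / 2) (by norm_num) hc.norm ?_)
  refine Asymptotics.IsBigO.trans ?_ (Real.Gamma_integrand_isLittleO β.re).isBigO
  refine Asymptotics.IsBigO.of_norm_eventuallyLE ?_
  filter_upwards [eventually_gt_atTop 0] with t ht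
  rw [norm_norm, norm_weight β ht, mul_comm]

lemma integrableOn_weight {β : ℂ} (hβ : -1 < β.re) : IntegrableOn (weight β) (Set.Ioi 0) := by
  have h := Complex.GammaIntegral_convergent (s := β + 1) (by simpa using by linarith)
  refine h.congr_fun (fun t _ => ?_) measurableSet_Ioi
  simp only [weight, add_sub_cancel_right]
  push_cast
  ring

lemma exists_le_norm_sub {z : ℂ} (hz : z ∈ cutPlane) :
    ∃ δ : ℝ, 0 < δ ∧ ∀ t : ℝ, 0 ≤ t → δ ≤ ‖(t : ℂ) - z‖ := by
  by_cases him : z.im = 0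
  · have hre : z.re < 0 := by
      by_contra h
      exact hz ⟨not_lt.1 h, him⟩
    refine ⟨-z.re, by linarith, fun t ht => ?_⟩
    have h := Complex.abs_re_le_norm ((t : ℂ) - z)
    simp only [sub_re, ofReal_re] at h
    rw [abs_of_pos (by linarith)] at h
    linarith
  · refine ⟨|z.im|, abs_pos.2 him, fun t _ => ?_⟩
    have h := Complex.abs_im_le_norm ((t : ℂ) - z)
    simpa using h

lemma ofReal_sub_ne_zero {z : ℂ} (hz : z ∈ cutPlane) {t : ℝ} (ht : 0 ≤ t) : (t : ℂ) - z ≠ 0 := by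
  obtain ⟨δ, hδ, h⟩ := exists_le_norm_sub hz
  exact norm_pos_iff.1 (hδ.trans_le (h t ht))

lemma ne_zero_of_mem_cutPlane {z : ℂ} (hz : z ∈ cutPlane) : z ≠ 0 := by
  rintro rfl
  exact hz (by simp)

lemma integrableOn_div_pow {h : ℝ → ℂ} {ξ : ℝ} (hξ : 0 ≤ ξ) (hh : IntegrableOn h (Set.Ioi ξ))
    {z : ℂ} (hz : z ∈ cutPlane) (m : ℕ) :
    IntegrableOn (fun t : ℝ => h t / ((t : ℂ) - z) ^ m) (Set.Ioi ξ) := by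
  obtain ⟨δ, hδ, hle⟩ := exists_le_norm_sub hz
  simp_rw [div_eq_mul_inv]
  refine hh.mul_bdd (c := (δ ^ m)⁻¹) ?_ ?_
  · refine ContinuousOn.aestronglyMeasurable ?_ measurableSet_Ioi
    refine ContinuousOn.inv₀ (by fun_prop) fun t ht => pow_ne_zero _ ?_
    exact ofReal_sub_ne_zero hz (hξ.trans (le_of_lt ht))
  · refine (ae_restrict_iff' measurableSet_Ioi).2 (ae_of_all _ fun t ht => ?_)
    rw [norm_inv, norm_pow]
    gcongr
    exact hle t (hξ.trans (le_of_lt ht))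

lemma integrableOn_div {h : ℝ → ℂ} {ξ : ℝ} (hξ : 0 ≤ ξ) (hh : IntegrableOn h (Set.Ioi ξ))
    {z : ℂ} (hz : z ∈ cutPlane) :
    IntegrableOn (fun t : ℝ => h t / ((t : ℂ) - z)) (Set.Ioi ξ) := by
  simpa using integrableOn_div_pow hξ hh hz 1

lemma analyticOnNhd_exp_neg (s : Set ℂ) : AnalyticOnNhd ℂ (fun t : ℂ => exp (-t)) s :=
  fun _ _ => by fun_prop

lemma analyticOnNhd_exp_neg_div {z : ℂ} {ξ : ℝ} (hξ : ξ < ‖z‖) :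
    AnalyticOnNhd ℂ (fun t : ℂ => exp (-t) / (t - z)) (Metric.closedBall 0 ξ) := by
  intro t ht
  have h : t - z ≠ 0 := by
    intro h
    rw [sub_eq_zero.1 h, mem_closedBall_zero_iff] at ht
    linarith
  fun_prop (disch := exact h)

/-- The finite-part Stieltjes transform `f.p. ∫₀^∞ t^β e^(-t) / (t - z) dt`. -/
def expTransform (β z : ℂ) : ℂ := finitePart β (fun t => exp (-t) / (t - z))

lemma integrableOn_cpow_mul_exp_neg (β : ℂ) {ξ : ℝ} (hξ : 0 < ξ) :
    IntegrableOn (fun t : ℝ => (t : ℂ) ^ β * exp (-(t : ℂ))) (Set.Ioi ξ) :=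
  integrableOn_weight_Ioi β hξ

lemma integrableOn_cpow_mul_exp_neg_div (β : ℂ) {ξ : ℝ} (hξ : 0 < ξ) {z : ℂ}
    (hz : z ∈ cutPlane) :
    IntegrableOn (fun t : ℝ => (t : ℂ) ^ β * (exp (-(t : ℂ)) / (t - z))) (Set.Ioi ξ) := by
  refine (integrableOn_div hξ.le (integrableOn_weight_Ioi β hξ) hz).congr_fun (fun t _ => ?_)
    measurableSet_Ioi
  simp only [weight]
  ring

lemma expTransform_eq_integral {β : ℂ} (hβ : -1 < β.re) {z : ℂ} (hz : z ∈ cutPlane) :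
    expTransform β z = ∫ t in Set.Ioi (0 : ℝ), weight β t / (t - z) := by
  have hz0 : 0 < ‖z‖ := norm_pos_iff.2 (ne_zero_of_mem_cutPlane hz)
  have he : ∀ t : ℝ, (t : ℂ) ^ β * (exp (-(t : ℂ)) / (t - z)) = weight β t / (t - z) := by
    intro t
    rw [weight]
    ring
  rw [expTransform, finitePart_eq_integral hβ (half_pos hz0)
    (analyticOnNhd_exp_neg_div (half_lt_self hz0))]
  · simp_rw [he]
  · simp_rw [he]
    exact integrableOn_div le_rfl (integrableOn_weight hβ) hz

lemma hasDerivAt_weight (β : ℂ) {t : ℝ} (ht : 0 < t) :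
    HasDerivAt (weight β) (β * weight (β - 1) t - weight β t) t := by
  have hd : HasDerivAt (fun z : ℂ => z ^ β * exp (-z))
      ((β * (t : ℂ) ^ (β - 1) * 1) * exp (-(t : ℂ)) + (t : ℂ) ^ β * (exp (-(t : ℂ)) * (-1)))
      (t : ℂ) := by
    refine HasDerivAt.mul ?_ ?_
    · exact (hasDerivAt_id (t : ℂ)).cpow_const (by left; simpa using ht)
    · exact (hasDerivAt_neg (t : ℂ)).cexp
  refine hd.comp_ofReal.congr_deriv ?_
  rw [weight, weight]
  ring

lemma tendsto_weight_atTop (β : ℂ) : Tendsto (weight β) atTop (𝓝 0) := by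
  have h := tendsto_rpow_mul_exp_neg_mul_atTop_nhds_zero β.re 1 one_pos
  refine squeeze_zero_norm' ?_ h
  filter_upwards [eventually_gt_atTop 0] with t ht
  rw [norm_weight β ht, neg_one_mul]

/-- Integration by parts on each side of the splitting point 1; the boundary contributions e^(-1)
and -e^(-1) cancel. -/
lemma finitePart_exp_neg_add_one {β : ℂ} (hβ : ∀ k : ℕ, β ≠ -((k : ℂ) + 1)) :
    finitePart (β + 1) (fun t => exp (-t)) = (β + 1) * finitePart β (fun t => exp (-t)) := by
  have hβ' : ∀ k : ℕ, β + 1 ≠ -((k : ℂ) + 1) := fun k h => hβ (k + 1) (by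
    push_cast
    linear_combination h)
  have hexp : ∀ z : ℂ, ‖z‖ ≤ (1 : ℝ) →
      HasSum (fun n : ℕ => (-1) ^ n / (n.factorial : ℂ) * z ^ n) (exp (-z)) := by
    intro z _
    have h := NormedSpace.expSeries_div_hasSum_exp (-z)
    rw [← Complex.exp_eq_exp_ℂ] at h
    refine h.congr_fun fun n => ?_
    rw [neg_pow]
    ring
  have h1 : (β + 1) * finitePartTo (β + 1) (fun t => exp (-t)) 1 =
      exp (-1) + finitePartTo (β + 1 + 1) (fun t => exp (-t)) 1 := by
    have ha := (hasSum_finitePartTo one_pos hexp (β + 1)).mul_left (β + 1)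
    have hb := hasSum_finitePartTo one_pos hexp (β + 1 + 1)
    have hc := hexp 1 (by simp)
    refine ha.unique ?_
    rw [add_comm]
    -- Padding with a leading zero compares the term n + 1 of the series for β + 1 with the term n
    -- of the series for β + 2.
    have hsub := hc.add ((hasSum_nat_add_iff' (f := fun n : ℕ => (match n with
      | 0 => 0
      | n + 1 => ((1 : ℝ) : ℂ) ^ (β + 1 + 1) * ((-1) ^ n / (n.factorial : ℂ) *
          ((1 : ℝ) : ℂ) ^ n / ((n : ℂ) + (β + 1 + 1))) : ℂ)) 1).1 (by simpa using hb))
    rw [add_comm]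
    refine hsub.congr_fun fun n => ?_
    rcases n with _ | n
    · have : β + 1 ≠ 0 := fun h => hβ 0 (by push_cast; linear_combination h)
      simp [this]
    · have h2 : (n : ℂ) + 1 + (β + 1) ≠ 0 := fun h => hβ (n + 1) (by
        push_cast; linear_combination h)
      have h3 : (n : ℂ) + (β + 1 + 1) ≠ 0 := fun h => h2 (by linear_combination h)
      have h4 : (n.factorial : ℂ) ≠ 0 := by exact_mod_cast n.factorial_ne_zero
      have h5 : (n : ℂ) + 1 ≠ 0 := by exact_mod_cast n.succ_ne_zero
      simp only [Nat.factorial_succ, ofReal_one, one_cpow, one_pow]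
      push_cast
      rw [show (n : ℂ) + (β + 1 + 1) = n + 1 + (β + 1) by ring]
      field_simp
      ring
  have h2 : (β + 1) * ∫ t in Set.Ioi (1 : ℝ), (t : ℂ) ^ β * exp (-(t : ℂ)) =
      -exp (-1) + ∫ t in Set.Ioi (1 : ℝ), (t : ℂ) ^ (β + 1) * exp (-(t : ℂ)) := by
    have hi0 := (integrableOn_weight_Ioi β one_pos).const_mul (β + 1)
    have hi1 := integrableOn_weight_Ioi (β + 1) one_pos
    have h := integral_Ioi_of_hasDerivAt_of_tendsto (a := 1) (f := weight (β + 1))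
      (f' := fun t => (β + 1) * weight β t - weight (β + 1) t) (m := 0)
      (hasDerivAt_weight (β + 1) one_pos).continuousAt.continuousWithinAt
      (fun t ht => by
        have := hasDerivAt_weight (β + 1) (one_pos.trans (Set.mem_Ioi.1 ht))
        simpa using this)
      (hi0.sub hi1) (tendsto_weight_atTop _)
    rw [integral_sub hi0 hi1, integral_const_mul] at h
    simp only [weight, ofReal_one, one_cpow, one_mul] at h
    linear_combination h
  rw [finitePart_eq hβ one_pos (analyticOnNhd_exp_neg _) (integrableOn_cpow_mul_exp_neg β one_pos),
    finitePart_eq hβ' one_pos (analyticOnNhd_exp_neg _)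
      (integrableOn_cpow_mul_exp_neg (β + 1) one_pos)]
  linear_combination -h1 - h2

/-- Both sides obey the same functional equation, and they agree by Euler's integral once Re β > 0;
k bounds the number of raisings needed. -/
lemma finitePart_exp_neg {β : ℂ} (hβ : ∀ k : ℕ, β ≠ -((k : ℂ) + 1)) :
    finitePart β (fun t => exp (-t)) = Gamma (β + 1) := by
  obtain ⟨k, hk⟩ := exists_nat_gt (-β.re)
  induction k generalizing β with
  | zero =>
    have h0 : 0 < β.re := by simpa using hk
    rw [finitePart_eq_integral (ξ := 1) (by linarith) one_pos (analyticOnNhd_exp_neg _)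
      (integrableOn_weight (β := β) (by linarith)), Complex.Gamma_eq_integral (by simp; linarith),
      Complex.GammaIntegral]
    refine setIntegral_congr_fun measurableSet_Ioi fun t _ => ?_
    simp only [add_sub_cancel_right]
    push_cast
    ring
  | succ k ih =>
    have hβ' : ∀ k : ℕ, β + 1 ≠ -((k : ℂ) + 1) := fun k h => hβ (k + 1) (by
      push_cast
      linear_combination h)
    have h0 : β + 1 ≠ 0 := fun h => hβ 0 (by push_cast; linear_combination h)
    have h := ih hβ' (by
      push_cast at hk
      simp
      linarith)
    rw [finitePart_exp_neg_add_one hβ, Complex.Gamma_add_one _ h0] at h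
    exact mul_left_cancel₀ h0 h

lemma add_one_ne {β : ℂ} (hβ : ∀ k : ℕ, β ≠ -((k : ℂ) + 1)) (k : ℕ) :
    β + 1 ≠ -((k : ℂ) + 1) := fun h => hβ (k + 1) (by
  push_cast
  linear_combination h)

lemma add_natCast_ne {β : ℂ} (hβ : ∀ k : ℕ, β ≠ -((k : ℂ) + 1)) (m k : ℕ) :
    β + m ≠ -((k : ℂ) + 1) := fun h => hβ (k + m) (by
  push_cast
  linear_combination h)

/-- The recursion which raises the exponent by one. -/
lemma mul_expTransform {β : ℂ} (hβ : ∀ k : ℕ, β ≠ -((k : ℂ) + 1)) {z : ℂ} (hz : z ∈ cutPlane) :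
    z * expTransform β z = expTransform (β + 1) z - Gamma (β + 1) := by
  have hz0 : 0 < ‖z‖ := norm_pos_iff.2 (ne_zero_of_mem_cutPlane hz)
  have hξ := half_pos hz0
  have ha := analyticOnNhd_exp_neg_div (half_lt_self hz0)
  have hi := integrableOn_cpow_mul_exp_neg_div β hξ hz
  -- The whole recursion is z/(t - z) + 1 = t/(t - z) under the finite part. The splitting point
  -- |z|/2 keeps the pole t = z outside the disk.
  have hs : ∀ t : ℂ, t ≠ z → z * (exp (-t) / (t - z)) + exp (-t) = t * (exp (-t) / (t - z)) := by
    intro t ht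
    have : t - z ≠ 0 := sub_ne_zero.2 ht
    field_simp
    ring
  have h1 := finitePart_id_mul hβ hξ ha (integrableOn_cpow_mul_exp_neg_div (β + 1) hξ hz)
  have h2 := finitePart_add hβ hξ (analyticOnNhd_const.mul ha) (analyticOnNhd_exp_neg _)
    (by
      refine IntegrableOn.congr_fun (hi.const_mul z) (fun t _ => ?_) measurableSet_Ioi
      ring) (integrableOn_cpow_mul_exp_neg β hξ)
  rw [finitePart_const_mul hβ z hξ ha hi, finitePart_exp_neg hβ] at h2
  rw [expTransform, expTransform, ← h1, eq_sub_iff_add_eq, ← h2]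
  refine finitePart_congr hβ hξ ((analyticOnNhd_const.mul ha).add (analyticOnNhd_exp_neg _))
    (analyticOnNhd_id.mul ha) (fun t ht => hs t ?_) (fun t ht => hs t ?_) ?_
  · rintro rfl
    rw [mem_closedBall_zero_iff] at ht
    linarith
  · exact sub_ne_zero.1 (ofReal_sub_ne_zero hz (hξ.le.trans (le_of_lt ht)))
  · refine (integrableOn_cpow_mul_exp_neg_div (β + 1) hξ hz).congr_fun (fun t ht => ?_)
      measurableSet_Ioi
    simp only
    rw [cpow_add_one_ofReal (hξ.trans ht)]
    ring

/-! ### The differential equation of the transform -/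

lemma mem_cutPlane_iff {z : ℂ} : z ∈ cutPlane ↔ -z ∈ slitPlane := by
  simp only [cutPlane, Set.mem_ofPred_eq, mem_slitPlane_iff, neg_re, neg_im, Left.neg_pos_iff,
    neg_ne_zero, not_and_or, not_le, ne_eq]

lemma cutPlane_eq : cutPlane = Neg.neg ⁻¹' slitPlane := by
  ext z
  exact mem_cutPlane_iff

lemma isOpen_cutPlane : IsOpen cutPlane := by
  rw [cutPlane_eq]
  exact isOpen_slitPlane.preimage continuous_neg

lemma isPreconnected_cutPlane : IsPreconnected cutPlane := by
  have h : cutPlane = Neg.neg '' slitPlane := by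
    rw [cutPlane_eq]
    simp
  rw [h]
  exact (starConvex_one_slitPlane.isPathConnected
    one_mem_slitPlane).isConnected.isPreconnected.image _
    continuous_neg.continuousOn

lemma mem_cutPlane_of_im_ne_zero {z : ℂ} (hz : z.im ≠ 0) : z ∈ cutPlane := fun h => hz h.2

lemma hasDerivAt_expTransform_integral {β : ℂ} (hβ : -1 < β.re) {z : ℂ} (hz : z ∈ cutPlane) :
    HasDerivAt (expTransform β) (∫ t in Set.Ioi (0 : ℝ), weight β t / ((t : ℂ) - z) ^ 2) z := by
  obtain ⟨δ, hδ, hle⟩ := exists_le_norm_sub hz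
  have hball : ∀ w ∈ Metric.ball z (δ / 2), ∀ t : ℝ, 0 ≤ t → δ / 2 ≤ ‖(t : ℂ) - w‖ := by
    intro w hw t ht
    have h1 := hle t ht
    have h2 : ‖(t : ℂ) - z‖ ≤ ‖(t : ℂ) - w‖ + ‖w - z‖ := norm_sub_le_norm_sub_add_norm_sub _ _ _
    rw [mem_ball_iff_norm] at hw
    linarith
  have hw := integrableOn_weight hβ
  have hmeas : ∀ w ∈ cutPlane, AEStronglyMeasurable (fun t : ℝ => weight β t / ((t : ℂ) - w))
      (volume.restrict (Set.Ioi 0)) := fun w hw' => (integrableOn_div le_rfl hw hw').1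
  have key := hasDerivAt_integral_of_dominated_loc_of_deriv_le
    (μ := volume.restrict (Set.Ioi (0 : ℝ)))
    (F := fun (w : ℂ) (t : ℝ) => weight β t / ((t : ℂ) - w))
    (F' := fun (w : ℂ) (t : ℝ) => weight β t / ((t : ℂ) - w) ^ 2)
    (bound := fun t => ‖weight β t‖ / (δ / 2) ^ 2)
    (x₀ := z) (Metric.ball_mem_nhds z (half_pos hδ))
    (by
      filter_upwards [isOpen_cutPlane.mem_nhds hz] with w hw'
      exact hmeas w hw')
    (integrableOn_div le_rfl hw hz) (integrableOn_div_pow le_rfl hw hz 2).1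
    (by
      refine (ae_restrict_iff' measurableSet_Ioi).2 (ae_of_all _ fun t ht w hw' => ?_)
      rw [norm_div, norm_pow]
      gcongr
      exact hball w hw' t (le_of_lt ht))
    (hw.norm.div_const _)
    (by
      refine (ae_restrict_iff' measurableSet_Ioi).2 (ae_of_all _ fun t ht w hw' => ?_)
      have hne : (t : ℂ) - w ≠ 0 :=
        norm_pos_iff.1 ((half_pos hδ).trans_le (hball w hw' t (le_of_lt ht)))
      have h := (hasDerivAt_const w (weight β t)).div ((hasDerivAt_id w).const_sub (t : ℂ)) hne
      refine h.congr_deriv ?_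
      simp)
  refine key.2.congr_of_eventuallyEq ?_
  filter_upwards [isOpen_cutPlane.mem_nhds hz] with w hw'
  exact expTransform_eq_integral hβ hw'

lemma tendsto_weight_zero {β : ℂ} (hβ : 0 < β.re) : Tendsto (weight β) (𝓝[>] 0) (𝓝 0) := by
  have h : Tendsto (fun t : ℝ => t ^ β.re * Real.exp (-t)) (𝓝[>] 0) (𝓝 0) := by
    have h1 : ContinuousAt (fun t : ℝ => t ^ β.re * Real.exp (-t)) 0 :=
      (Real.continuousAt_rpow_const 0 β.re (Or.inr hβ.le)).mul (by fun_prop)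
    have h2 := h1.tendsto
    rw [Real.zero_rpow hβ.ne', zero_mul] at h2
    exact h2.mono_left nhdsWithin_le_nhds
  refine squeeze_zero_norm' ?_ h
  filter_upwards [self_mem_nhdsWithin] with t ht
  rw [norm_weight β ht]

/-- Integration by parts for w(t)/(t - z); there are no boundary terms, since Re β > 0 makes w
vanish at 0. -/
lemma integral_weight_div_sq {β : ℂ} (hβ : 0 < β.re) {z : ℂ} (hz : z ∈ cutPlane) :
    ∫ t in Set.Ioi (0 : ℝ), weight β t / ((t : ℂ) - z) ^ 2 =
      β * expTransform (β - 1) z - expTransform β z := by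
  have hβ1 : -1 < (β - 1).re := by simpa using hβ
  have hβ0 : -1 < β.re := by linarith
  have hi1 := (integrableOn_div le_rfl (integrableOn_weight hβ1) hz).const_mul β
  have hi0 := integrableOn_div le_rfl (integrableOn_weight hβ0) hz
  have hi2 := integrableOn_div_pow le_rfl (integrableOn_weight hβ0) hz 2
  have hi10 : IntegrableOn (fun t : ℝ => β * (weight (β - 1) t / ((t : ℂ) - z)) -
      weight β t / ((t : ℂ) - z)) (Set.Ioi 0) := Integrable.sub hi1 hi0
  have h0 : weight β 0 = 0 := by
    have : β ≠ 0 := by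
      rintro rfl
      simp at hβ
    simp [weight, this]
  have h := integral_Ioi_of_hasDerivAt_of_tendsto (a := 0)
    (f := fun t => weight β t / ((t : ℂ) - z))
    (f' := fun t => β * (weight (β - 1) t / ((t : ℂ) - z)) - weight β t / ((t : ℂ) - z)
      - weight β t / ((t : ℂ) - z) ^ 2) (m := 0)
    (by
      have hc : ContinuousWithinAt (weight β) (Set.Ici 0) 0 := by
        rw [← Set.insert_eq_of_mem (Set.self_mem_Ici (a := (0 : ℝ))), ← Set.Ioi_insert,
          Set.insert_idem, continuousWithinAt_insert_self]
        unfold ContinuousWithinAt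
        rw [h0]
        exact tendsto_weight_zero hβ
      refine hc.div (by fun_prop) ?_
      simpa using ofReal_sub_ne_zero hz le_rfl)
    (fun t ht => by
      have hne := ofReal_sub_ne_zero hz (le_of_lt ht)
      have h1 : HasDerivAt (fun t : ℝ => (t : ℂ) - z) 1 t := by
        simpa using ((hasDerivAt_id (t : ℂ)).comp_ofReal).sub_const z
      refine ((hasDerivAt_weight β ht).div h1 hne).congr_deriv ?_
      field_simp)
    (Integrable.sub hi10 hi2)
    (by
      obtain ⟨δ, hδ, hle⟩ := exists_le_norm_sub hz
      have h1 := (tendsto_weight_atTop β).norm.mul_const δ⁻¹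
      rw [norm_zero, zero_mul] at h1
      refine squeeze_zero_norm' ?_ h1
      filter_upwards [eventually_ge_atTop 0] with t ht
      rw [norm_div, div_eq_mul_inv]
      gcongr
      exact hle t ht)
  rw [integral_sub hi10 hi2, integral_sub hi1 hi0, integral_const_mul,
    ← expTransform_eq_integral hβ1 hz, ← expTransform_eq_integral hβ0 hz, h0] at h
  linear_combination -h

/-- The transform satisfies `z (G' + G) = β G - Γ(β + 1)`. -/
lemma hasDerivAt_expTransform {β : ℂ} (hβ : ∀ k : ℕ, β ≠ -((k : ℂ) + 1)) {z : ℂ}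
    (hz : z ∈ cutPlane) :
    HasDerivAt (expTransform β)
      ((β * expTransform β z - Gamma (β + 1)) / z - expTransform β z) z := by
  obtain ⟨k, hk⟩ := exists_nat_gt (-β.re)
  have hz0 := ne_zero_of_mem_cutPlane hz
  -- For Re β > 0 the integral is differentiated directly; otherwise G_β = (G_{β+1} - Γ(β+1))/z is
  -- differentiated, using the equation for β + 1.
  induction k generalizing β with
  | zero =>
    have h0 : 0 < β.re := by simpa using hk
    have hβ1 : ∀ k : ℕ, β - 1 ≠ -((k : ℂ) + 1) := by
      intro k h
      have h1 := congrArg Complex.re h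
      simp at h1
      have : (0 : ℝ) ≤ k := k.cast_nonneg
      linarith
    have hne : β ≠ 0 := by
      rintro rfl
      simp at h0
    have h := hasDerivAt_expTransform_integral (by linarith) hz
    rw [integral_weight_div_sq h0 hz] at h
    refine h.congr_deriv ?_
    have h1 := mul_expTransform hβ1 hz
    rw [sub_add_cancel] at h1
    rw [Complex.Gamma_add_one _ hne]
    field_simp
    linear_combination β * h1
  | succ k ih =>
    have hβ1 := add_one_ne hβ
    have h0 : β + 1 ≠ 0 := fun h => hβ 0 (by push_cast; linear_combination h)
    have h := ih hβ1 (by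
      push_cast at hk
      simp
      linarith)
    have h1 := mul_expTransform hβ hz
    have h2 := (h.sub_const (Gamma (β + 1))).div (hasDerivAt_id z) hz0
    have h3 := h2.congr_of_eventuallyEq (f₁ := expTransform β) (by
      filter_upwards [isOpen_cutPlane.mem_nhds hz] with w hw
      have := ne_zero_of_mem_cutPlane hw
      have h4 := mul_expTransform hβ hw
      simp only [Pi.div_apply, id]
      field_simp
      linear_combination h4)
    refine h3.congr_deriv ?_
    rw [Complex.Gamma_add_one _ h0]
    have h5 : expTransform (β + 1) z = z * expTransform β z + Gamma (β + 1) := by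
      linear_combination -h1
    rw [h5]
    simp only [id]
    field_simp
    ring

lemma analyticOnNhd_expTransform {β : ℂ} (hβ : ∀ k : ℕ, β ≠ -((k : ℂ) + 1)) :
    AnalyticOnNhd ℂ (expTransform β) cutPlane :=
  DifferentiableOn.analyticOnNhd
    (fun _ hz => (hasDerivAt_expTransform hβ hz).differentiableAt.differentiableWithinAt)
    isOpen_cutPlane

/-! ### Solving the differential equation explicitly. -/

lemma cutPow_ne_zero (β z : ℂ) : cutPow β z ≠ 0 := exp_ne_zero _

lemma hasDerivAt_log_neg {z : ℂ} (hz : z ∈ cutPlane) :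
    HasDerivAt (fun w : ℂ => log (-w)) z⁻¹ z := by
  refine ((hasDerivAt_neg z).clog (mem_cutPlane_iff.1 hz)).congr_deriv ?_
  rw [neg_div_neg_eq, one_div]

lemma hasDerivAt_cutPow (β : ℂ) {z : ℂ} (hz : z ∈ cutPlane) :
    HasDerivAt (cutPow β) (β / z * cutPow β z) z := by
  have h := (((hasDerivAt_log_neg hz).add_const (Real.pi * I : ℂ)).const_mul β).cexp
  refine h.congr_deriv ?_
  rw [cutPow]
  ring

lemma cutPow_natCast (m : ℕ) {z : ℂ} (hz : z ≠ 0) : cutPow m z = z ^ m := by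
  rw [cutPow, exp_nat_mul, exp_add, exp_log (neg_ne_zero.2 hz), exp_pi_mul_I]
  ring

lemma cutPow_add (β γ z : ℂ) : cutPow (β + γ) z = cutPow β z * cutPow γ z := by
  rw [cutPow, cutPow, cutPow, ← exp_add, add_mul]

/-- Any particular solution of the differential equation describes the transform up to a multiple
of the solution of the homogeneous equation. -/
lemma exists_expTransform_eq {β : ℂ} (hβ : ∀ k : ℕ, β ≠ -((k : ℂ) + 1)) {P : ℂ → ℂ}
    (hP : ∀ z ∈ cutPlane, HasDerivAt P ((β * P z - Gamma (β + 1) * exp z) / z) z) :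
    ∃ K : ℂ, ∀ z ∈ cutPlane, expTransform β z = exp (-z) * (K * cutPow β z + P z) := by
  -- Variation of constants: e^z G and P solve the same inhomogeneous equation, so their difference
  -- divided by z^β has derivative zero on the connected slit plane.
  have hQ : ∀ z ∈ cutPlane,
      HasDerivAt (fun w => (exp w * expTransform β w - P w) / cutPow β w) 0 z := by
    intro z hz
    have hz0 := ne_zero_of_mem_cutPlane hz
    refine ((((Complex.hasDerivAt_exp z).mul (hasDerivAt_expTransform hβ hz)).sub (hP z hz)).div
      (hasDerivAt_cutPow β hz) (cutPow_ne_zero β z)).congr_deriv ?_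
    simp only [Pi.sub_apply, Pi.mul_apply]
    have := cutPow_ne_zero β z
    field_simp
    ring
  obtain ⟨K, hK⟩ := isOpen_cutPlane.exists_is_const_of_deriv_eq_zero isPreconnected_cutPlane
    (fun z hz => (hQ z hz).differentiableAt.differentiableWithinAt)
    (fun z hz => (hQ z hz).deriv)
  refine ⟨K, fun z hz => ?_⟩
  have h := hK z hz
  rw [div_eq_iff (cutPow_ne_zero β z)] at h
  rw [← h, sub_add_cancel, ← mul_assoc, ← exp_add]
  simp

/-- The entire function `∑ zⁿ / (n! (n - β))`, the sum being over all `n ≠ β`. -/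
def expShift (β z : ℂ) : ℂ := ∑' n : ℕ, z ^ n / (n.factorial : ℂ) / ((n : ℂ) - β)

lemma summable_pow_div_factorial (z : ℂ) : Summable fun n : ℕ => z ^ n / (n.factorial : ℂ) :=
  (NormedSpace.expSeries_div_hasSum_exp z).summable

lemma summable_expShift (β z : ℂ) :
    Summable fun n : ℕ => ‖z ^ n / (n.factorial : ℂ) / ((n : ℂ) - β)‖ := by
  simpa [sub_eq_add_neg] using summable_norm_div_natCast_add (-β) (summable_pow_div_factorial z)

lemma norm_expShift_term_le (β : ℂ) {w : ℂ} {R : ℝ} (hw : w ∈ Metric.ball (0 : ℂ) R) (n : ℕ) :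
    ‖w ^ n / (n.factorial : ℂ) / ((n : ℂ) - β)‖ ≤
      ‖(R : ℂ) ^ n / (n.factorial : ℂ) / ((n : ℂ) - β)‖ := by
  rw [mem_ball_zero_iff] at hw
  have hR : ‖w‖ ≤ ‖(R : ℂ)‖ := by
    rw [Complex.norm_real]
    exact hw.le.trans (le_abs_self R)
  simp only [norm_div, norm_pow]
  gcongr

lemma differentiable_expShift (β : ℂ) : Differentiable ℂ (expShift β) := by
  intro z
  obtain ⟨R, hR⟩ := exists_gt ‖z‖
  have hz : z ∈ Metric.ball (0 : ℂ) R := by simpa using hR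
  exact (differentiableOn_tsum_of_summable_norm (summable_expShift β R)
    (fun n => by fun_prop) Metric.isOpen_ball
    (fun n w hw => norm_expShift_term_le β hw n)).differentiableAt (Metric.isOpen_ball.mem_nhds hz)

/-- The operator z d/dz - β multiplies zⁿ by n - β and so cancels the denominators. At a resonance n
= β the term of `expShift` is 0, as division by zero gives 0, and the exponential series loses that
term. -/
lemma deriv_expShift (β z : ℂ) :
    z * deriv (expShift β) z = β * expShift β z +
      ∑' n : ℕ, if (n : ℂ) = β then 0 else z ^ n / (n.factorial : ℂ) := by
  obtain ⟨R, hR⟩ := exists_gt ‖z‖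
  have hz : z ∈ Metric.ball (0 : ℂ) R := by simpa using hR
  have h1 := (hasSum_deriv_of_summable_norm (summable_expShift β R)
    (fun n => by fun_prop) Metric.isOpen_ball
    (fun n w hw => norm_expShift_term_le β hw n) hz).mul_left z
  have h2 := (summable_expShift β z).of_norm.hasSum.mul_left β
  have h3 := (h1.sub h2).tsum_eq
  rw [eq_sub_iff_add_eq] at h3
  refine h3.symm.trans ?_
  rw [add_comm]
  congr 1
  refine tsum_congr fun n => ?_
  have h4 : deriv (fun w : ℂ => w ^ n / (n.factorial : ℂ) / ((n : ℂ) - β)) z =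
      n * z ^ (n - 1) / (n.factorial : ℂ) / ((n : ℂ) - β) := by
    simp
  rw [h4]
  have h5 : z * (n * z ^ (n - 1)) = n * z ^ n := by
    rcases n with _ | n
    · simp
    · simp [pow_succ]
      ring
  have h6 : z * (n * z ^ (n - 1) / (n.factorial : ℂ) / ((n : ℂ) - β)) =
      n * z ^ n / (n.factorial : ℂ) / ((n : ℂ) - β) := by
    rw [← h5]
    ring
  rw [h6]
  split_ifs with h
  · simp [h]
  · have h7 : (n : ℂ) - β ≠ 0 := sub_ne_zero.2 h
    have h8 : (n.factorial : ℂ) ≠ 0 := by exact_mod_cast n.factorial_ne_zero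
    field_simp

lemma hasSum_pow_div_factorial (z : ℂ) :
    HasSum (fun n : ℕ => z ^ n / (n.factorial : ℂ)) (exp z) := by
  have h := NormedSpace.expSeries_div_hasSum_exp z
  rwa [← Complex.exp_eq_exp_ℂ] at h

lemma exists_expTransform_eq_of_ne_natCast {β : ℂ} (hβ : ∀ k : ℕ, β ≠ -((k : ℂ) + 1))
    (hn : ∀ m : ℕ, β ≠ m) :
    ∃ (K : ℂ) (A : ℂ → ℂ), Differentiable ℂ A ∧
      ∀ z ∈ cutPlane, expTransform β z = exp (-z) * (K * cutPow β z + A z) := by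
  obtain ⟨K, hK⟩ := exists_expTransform_eq hβ (P := fun z => -Gamma (β + 1) * expShift β z) (by
    intro z hz
    have hz0 := ne_zero_of_mem_cutPlane hz
    refine ((differentiable_expShift β z).hasDerivAt.const_mul _).congr_deriv ?_
    have h := deriv_expShift β z
    simp only [fun n : ℕ => (hn n).symm, if_false] at h
    rw [(hasSum_pow_div_factorial z).tsum_eq] at h
    field_simp
    linear_combination -Gamma (β + 1) * h)
  exact ⟨K, _, (differentiable_expShift β).const_mul _, hK⟩

/-- The resonant case. The missing term z^m/m! is restored by the logarithm, since z d/dz - m sends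
z^m log(-z) to z^m and Γ(m+1) = m!. -/
lemma exists_expTransform_natCast_eq (m : ℕ) :
    ∃ (K : ℂ) (A : ℂ → ℂ), Differentiable ℂ A ∧ ∀ z ∈ cutPlane,
      expTransform m z = exp (-z) * (K * cutPow m z + (A z - z ^ m * log (-z))) := by
  have hβ : ∀ k : ℕ, (m : ℂ) ≠ -((k : ℂ) + 1) := by
    intro k h
    have h1 : (m : ℂ) + (k + 1) = 0 := by linear_combination h
    norm_cast at h1
  obtain ⟨K, hK⟩ := exists_expTransform_eq hβ
    (P := fun z => -(m.factorial : ℂ) * expShift m z - z ^ m * log (-z)) (by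
    intro z hz
    have hz0 := ne_zero_of_mem_cutPlane hz
    refine (((differentiable_expShift m z).hasDerivAt.const_mul _).sub
      ((hasDerivAt_pow m z).mul (hasDerivAt_log_neg hz))).congr_deriv ?_
    have h := deriv_expShift m z
    have h1 : ∑' n : ℕ, (if (n : ℂ) = m then 0 else z ^ n / (n.factorial : ℂ)) =
        exp z - z ^ m / (m.factorial : ℂ) := by
      have h2 := (hasSum_pow_div_factorial z).sub (hasSum_ite_eq m (z ^ m / (m.factorial : ℂ)))
      rw [← h2.tsum_eq]
      refine tsum_congr fun n => ?_
      by_cases hnm : n = m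
      · simp [hnm]
      · simp [hnm]
    rw [h1] at h
    have h8 : (m.factorial : ℂ) ≠ 0 := by exact_mod_cast m.factorial_ne_zero
    have h5 : z * (m * z ^ (m - 1)) = m * z ^ m := by
      rcases m with _ | n
      · simp
      · simp [pow_succ]
        ring
    have h9 : (m.factorial : ℂ) * (z ^ m / (m.factorial : ℂ)) = z ^ m := by field_simp
    rw [Complex.Gamma_nat_eq_factorial, eq_div_iff hz0]
    have h10 : z ^ m * z⁻¹ * z = z ^ m := by field_simp
    linear_combination -(m.factorial : ℂ) * h + h9 - log (-z) * h5 - h10)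
  exact ⟨K, _, (differentiable_expShift m).const_mul _, hK⟩

/-! ### Boundary values and behaviour at the origin -/

lemma tendsto_log_neg_above {x : ℝ} (hx : 0 < x) :
    Tendsto (fun z : ℂ => log (-z)) (𝓝[{z | 0 < z.im}] (x : ℂ))
      (𝓝 (Real.log x - Real.pi * I)) := by
  have h := tendsto_log_nhdsWithin_im_neg_of_re_neg_of_im_zero (z := -(x : ℂ)) (by simpa) (by simp)
  rw [norm_neg, Complex.norm_real, Real.norm_eq_abs, abs_of_pos hx] at h
  refine h.comp (tendsto_nhdsWithin_of_tendsto_nhds_of_eventually_within _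
    (continuous_neg.tendsto _ |>.mono_left nhdsWithin_le_nhds) ?_)
  filter_upwards [self_mem_nhdsWithin] with z hz
  simpa using hz

lemma tendsto_log_neg_below {x : ℝ} (hx : 0 < x) :
    Tendsto (fun z : ℂ => log (-z)) (𝓝[{z | z.im < 0}] (x : ℂ))
      (𝓝 (Real.log x + Real.pi * I)) := by
  have h := tendsto_log_nhdsWithin_im_nonneg_of_re_neg_of_im_zero (z := -(x : ℂ)) (by simpa)
    (by simp)
  rw [norm_neg, Complex.norm_real, Real.norm_eq_abs, abs_of_pos hx] at h
  refine h.comp (tendsto_nhdsWithin_of_tendsto_nhds_of_eventually_within _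
    (continuous_neg.tendsto _ |>.mono_left nhdsWithin_le_nhds) ?_)
  filter_upwards [self_mem_nhdsWithin] with z hz
  simpa using le_of_lt hz

/-- In the explicit form everything except log(-z) is continuous, `cutPow` being itself a function
of log(-z). A general filter serves both sides of the cut at once. -/
lemma exists_tendsto_expTransform_of_log {β : ℂ} (hβ : ∀ k : ℕ, β ≠ -((k : ℂ) + 1))
    {l : Filter ℂ} {x ℓ : ℂ} (hl : l ≤ 𝓝 x) (hlc : ∀ᶠ z in l, z ∈ cutPlane)
    (h : Tendsto (fun z : ℂ => log (-z)) l (𝓝 ℓ)) :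
    ∃ L : ℂ, Tendsto (expTransform β) l (𝓝 L) := by
  have hc : Tendsto (cutPow β) l (𝓝 (exp (β * (ℓ + Real.pi * I)))) :=
    (((h.add_const _).const_mul β).cexp)
  have hid : Tendsto (fun z : ℂ => z) l (𝓝 x) := hl
  have he : Tendsto (fun z : ℂ => exp (-z)) l (𝓝 (exp (-x))) := hid.neg.cexp
  by_cases hn : ∃ m : ℕ, β = m
  · obtain ⟨m, rfl⟩ := hn
    obtain ⟨K, A, hA, hG⟩ := exists_expTransform_natCast_eq m
    have hA' : Tendsto A l (𝓝 (A x)) := (hA.continuous.tendsto x).mono_left hl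
    refine ⟨_, (he.mul ((hc.const_mul K).add (hA'.sub ((hid.pow m).mul h)))).congr' ?_⟩
    filter_upwards [hlc] with z hz
    exact (hG z hz).symm
  · push Not at hn
    obtain ⟨K, A, hA, hG⟩ := exists_expTransform_eq_of_ne_natCast hβ hn
    have hA' : Tendsto A l (𝓝 (A x)) := (hA.continuous.tendsto x).mono_left hl
    refine ⟨_, (he.mul ((hc.const_mul K).add hA')).congr' ?_⟩
    filter_upwards [hlc] with z hz
    exact (hG z hz).symm

lemma tendsto_vertical_above (x : ℝ) :
    Tendsto (fun c : ℝ => (x : ℂ) + (c⁻¹ : ℝ) * I) atTop (𝓝[{z | 0 < z.im}] (x : ℂ)) := by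
  refine tendsto_nhdsWithin_of_tendsto_nhds_of_eventually_within _ ?_ ?_
  · have h : Tendsto (fun c : ℝ => ((c⁻¹ : ℝ) : ℂ)) atTop (𝓝 ((0 : ℝ) : ℂ)) :=
      (continuous_ofReal.tendsto 0).comp tendsto_inv_atTop_zero
    simpa using (h.mul_const I).const_add (x : ℂ)
  · filter_upwards [eventually_gt_atTop 0] with c hc
    simpa using hc

lemma tendsto_vertical_below (x : ℝ) :
    Tendsto (fun c : ℝ => (x : ℂ) - (c⁻¹ : ℝ) * I) atTop (𝓝[{z | z.im < 0}] (x : ℂ)) := by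
  refine tendsto_nhdsWithin_of_tendsto_nhds_of_eventually_within _ ?_ ?_
  · have h : Tendsto (fun c : ℝ => ((c⁻¹ : ℝ) : ℂ)) atTop (𝓝 ((0 : ℝ) : ℂ)) :=
      (continuous_ofReal.tendsto 0).comp tendsto_inv_atTop_zero
    simpa using (h.mul_const I).const_sub (x : ℂ)
  · filter_upwards [eventually_gt_atTop 0] with c hc
    simpa using hc

/-- At height 1/c above and below x the two Cauchy kernels differ by 2πi times the Poisson kernel c
φ(c(x - t)) with φ(s) = 1/(π(1 + s²)), an approximate identity as c → ∞. -/
lemma tendsto_expTransform_vertical_sub {β : ℂ} (hβ : -1 < β.re) {x : ℝ} (hx : 0 < x) :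
    Tendsto (fun c : ℝ => expTransform β ((x : ℂ) + (c⁻¹ : ℝ) * I) -
      expTransform β ((x : ℂ) - (c⁻¹ : ℝ) * I)) atTop (𝓝 (2 * Real.pi * I * weight β x)) := by
  set g : ℝ → ℂ := (Set.Ioi (0 : ℝ)).indicator (weight β) with hg
  have hgi : Integrable g := (integrable_indicator_iff measurableSet_Ioi).2 (integrableOn_weight hβ)
  have hgx : g x = weight β x := Set.indicator_of_mem (Set.mem_Ioi.2 hx) _
  have hgc : ContinuousAt g x := by
    refine ((continuousOn_weight β).continuousAt (Ioi_mem_nhds hx)).congr ?_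
    filter_upwards [Ioi_mem_nhds hx] with t ht
    exact (Set.indicator_of_mem ht _).symm
  have h := tendsto_integral_comp_smul_smul_of_integrable' (μ := volume)
    (φ := fun s : ℝ => Real.pi⁻¹ * (1 + s ^ 2)⁻¹) (fun s => by positivity)
    (by
      rw [integral_const_mul, integral_univ_inv_one_add_sq]
      exact inv_mul_cancel₀ Real.pi_ne_zero)
    (by
      have hb : ∀ s : ℝ, ‖s‖ ^ Module.finrank ℝ ℝ * (Real.pi⁻¹ * (1 + s ^ 2)⁻¹) ≤ ‖s‖⁻¹ := by
        intro s
        rw [Module.finrank_self, pow_one, Real.norm_eq_abs]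
        rcases eq_or_ne s 0 with rfl | hs
        · simp
        · have h1 : 0 < |s| := abs_pos.2 hs
          have h2 : (1 + s ^ 2)⁻¹ ≤ (|s| ^ 2)⁻¹ := by
            rw [sq_abs]
            gcongr
            linarith
          have h3 : Real.pi⁻¹ ≤ 1 := inv_le_one_of_one_le₀ (by linarith [Real.pi_gt_three])
          calc |s| * (Real.pi⁻¹ * (1 + s ^ 2)⁻¹) ≤ |s| * (1 * (|s| ^ 2)⁻¹) := by gcongr
            _ = |s|⁻¹ := by field_simp
      refine squeeze_zero (fun s => by positivity) hb ?_
      exact tendsto_inv_atTop_zero.comp tendsto_norm_cobounded_atTop)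
    hgi hgc
  rw [hgx] at h
  refine (h.const_mul (2 * Real.pi * I)).congr' ?_
  filter_upwards [eventually_gt_atTop 0] with c hc
  have hz1 : (x : ℂ) + (c⁻¹ : ℝ) * I ∈ cutPlane := mem_cutPlane_of_im_ne_zero (by simp [hc.ne'])
  have hz2 : (x : ℂ) - (c⁻¹ : ℝ) * I ∈ cutPlane := mem_cutPlane_of_im_ne_zero (by simp [hc.ne'])
  have hw := integrableOn_weight hβ
  rw [expTransform_eq_integral hβ hz1, expTransform_eq_integral hβ hz2,
    ← integral_sub (integrableOn_div le_rfl hw hz1) (integrableOn_div le_rfl hw hz2),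
    ← integral_const_mul, ← integral_indicator measurableSet_Ioi]
  congr 1
  ext t
  by_cases ht : t ∈ Set.Ioi (0 : ℝ)
  · rw [Set.indicator_of_mem ht, hg, Set.indicator_of_mem ht]
    have h1 := ofReal_sub_ne_zero hz1 (le_of_lt ht)
    have h2 := ofReal_sub_ne_zero hz2 (le_of_lt ht)
    have h3 : ((t : ℂ) - (x + (c⁻¹ : ℝ) * I)) * (t - (x - (c⁻¹ : ℝ) * I)) =
        (t - x) ^ 2 + ((c : ℂ) ^ 2)⁻¹ := by
      push_cast
      linear_combination -((c : ℂ) ^ 2)⁻¹ * I_sq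
    have h4 : ((t : ℂ) - x) ^ 2 + ((c : ℂ) ^ 2)⁻¹ ≠ 0 := h3 ▸ mul_ne_zero h1 h2
    have hc' : (c : ℂ) ≠ 0 := by exact_mod_cast hc.ne'
    have hpi : (Real.pi : ℂ) ≠ 0 := by exact_mod_cast Real.pi_ne_zero
    have h5 : 1 + ((c : ℂ) * (x - t)) ^ 2 ≠ 0 := by
      have : 1 + ((c : ℂ) * (x - t)) ^ 2 = (c : ℂ) ^ 2 * ((t - x) ^ 2 + ((c : ℂ) ^ 2)⁻¹) := by
        field_simp
        ring
      rw [this]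
      exact mul_ne_zero (pow_ne_zero _ hc') h4
    rw [div_sub_div _ _ h1 h2, h3]
    simp only [Module.finrank_self, pow_one, smul_eq_mul, real_smul]
    push_cast
    field_simp
    ring
  · rw [Set.indicator_of_notMem ht, hg, Set.indicator_of_notMem ht]
    simp

lemma eventually_mem_cutPlane_above (x : ℂ) : ∀ᶠ z in 𝓝[{z : ℂ | 0 < z.im}] x, z ∈ cutPlane := by
  filter_upwards [self_mem_nhdsWithin] with z hz
  exact mem_cutPlane_of_im_ne_zero (ne_of_gt hz)

lemma eventually_mem_cutPlane_below (x : ℂ) : ∀ᶠ z in 𝓝[{z : ℂ | z.im < 0}] x, z ∈ cutPlane := by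
  filter_upwards [self_mem_nhdsWithin] with z hz
  exact mem_cutPlane_of_im_ne_zero (ne_of_lt hz)

/-- The boundary values of the transform on the cut. -/
lemma exists_tendsto_expTransform {β : ℂ} (hβ : ∀ k : ℕ, β ≠ -((k : ℂ) + 1)) {x : ℝ}
    (hx : 0 < x) :
    ∃ Lp Lm : ℂ, Tendsto (expTransform β) (𝓝[{z | 0 < z.im}] (x : ℂ)) (𝓝 Lp) ∧
      Tendsto (expTransform β) (𝓝[{z | z.im < 0}] (x : ℂ)) (𝓝 Lm) ∧
      Lp - Lm = 2 * Real.pi * I * weight β x := by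
  obtain ⟨Lp, hp⟩ := exists_tendsto_expTransform_of_log hβ nhdsWithin_le_nhds
    (eventually_mem_cutPlane_above _) (tendsto_log_neg_above hx)
  obtain ⟨Lm, hm⟩ := exists_tendsto_expTransform_of_log hβ nhdsWithin_le_nhds
    (eventually_mem_cutPlane_below _) (tendsto_log_neg_below hx)
  refine ⟨Lp, Lm, hp, hm, ?_⟩
  obtain ⟨k, hk⟩ := exists_nat_gt (-β.re)
  -- Raising the exponent multiplies both boundary values by x and adds the same Γ(β+1), so the jump
  -- for β + 1 is x times the jump for β, and x ≠ 0 can be cancelled.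
  induction k generalizing β Lp Lm with
  | zero =>
    have h0 : 0 < β.re := by simpa using hk
    exact tendsto_nhds_unique
      ((hp.comp (tendsto_vertical_above x)).sub (hm.comp (tendsto_vertical_below x)))
      (tendsto_expTransform_vertical_sub (by linarith) hx)
  | succ k ih =>
    have hraise : ∀ {l : Filter ℂ} {L : ℂ}, l ≤ 𝓝 (x : ℂ) → (∀ᶠ z in l, z ∈ cutPlane) →
        Tendsto (expTransform β) l (𝓝 L) →
        Tendsto (expTransform (β + 1)) l (𝓝 (x * L + Gamma (β + 1))) := by
      intro l L hl hlc h
      have hid : Tendsto (fun z : ℂ => z) l (𝓝 (x : ℂ)) := hl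
      refine ((hid.mul h).add_const (Gamma (β + 1))).congr' ?_
      filter_upwards [hlc] with z hz
      linear_combination mul_expTransform hβ hz
    have h := ih (add_one_ne hβ) _ (hraise nhdsWithin_le_nhds (eventually_mem_cutPlane_above _) hp)
      _ (hraise nhdsWithin_le_nhds (eventually_mem_cutPlane_below _) hm) (by
        push_cast at hk
        simp
        linarith)
    rw [weight_add_one β hx] at h
    have hx' : (x : ℂ) ≠ 0 := by exact_mod_cast hx.ne'
    exact mul_left_cancel₀ hx' (by linear_combination h)

/-! ### Singularities of type z^α 𝒪₀ + O(1) at the origin. -/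

lemma IsPowGermAddBounded.add {α : ℂ} {f g : ℂ → ℂ} (hf : IsPowGermAddBounded α f)
    (hg : IsPowGermAddBounded α g) : IsPowGermAddBounded α (fun z => f z + g z) := by
  obtain ⟨f₀, hf₀, hf⟩ := hf
  obtain ⟨g₀, hg₀, hg⟩ := hg
  refine ⟨fun z => f₀ z + g₀ z, hf₀.add hg₀, (hf.add hg).congr_left fun z => ?_⟩
  ring

/-- Multiplication by a function which is analytic at the origin. -/
lemma IsPowGermAddBounded.mul_left {α : ℂ} {f a : ℂ → ℂ} (hf : IsPowGermAddBounded α f)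
    (ha : AnalyticAt ℂ a 0) : IsPowGermAddBounded α (fun z => a z * f z) := by
  obtain ⟨f₀, hf₀, hf⟩ := hf
  refine ⟨fun z => a z * f₀ z, ha.mul hf₀, ?_⟩
  have h1 : a =O[𝓝[cutPlane] 0] (fun _ => (1 : ℂ)) :=
    (ha.continuousAt.tendsto.mono_left nhdsWithin_le_nhds).isBigO_one ℂ
  have h2 := h1.mul hf
  rw [mul_one] at h2
  refine h2.congr_left fun z => ?_
  ring

lemma IsPowGermAddBounded.of_isBigO {α : ℂ} {f : ℂ → ℂ}
    (hf : f =O[𝓝[cutPlane] 0] (fun _ => (1 : ℂ))) : IsPowGermAddBounded α f :=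
  ⟨fun _ => 0, analyticAt_const, by simpa using hf⟩

/-- The integer power in z^(α+i) = z^α z^i is absorbed into the analytic germ. This brings all the
G_{α+i} into the class for α. -/
lemma IsPowGermAddBounded.of_add_natCast {α : ℂ} {i : ℕ} {f : ℂ → ℂ}
    (hf : IsPowGermAddBounded (α + i) f) : IsPowGermAddBounded α f := by
  obtain ⟨f₀, hf₀, hf⟩ := hf
  refine ⟨fun z => z ^ i * f₀ z, (analyticAt_id.pow i).mul hf₀, ?_⟩
  refine hf.congr' ?_ EventuallyEq.rfl
  filter_upwards [self_mem_nhdsWithin] with z hz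
  rw [cutPow_add, cutPow_natCast i (ne_zero_of_mem_cutPlane hz)]
  ring

lemma norm_log_le {z : ℂ} : ‖log z‖ ≤ |Real.log ‖z‖| + Real.pi := by
  refine (Complex.norm_le_abs_re_add_abs_im _).trans ?_
  rw [log_re, log_im]
  gcongr
  exact abs_arg_le_pi z

lemma isBigO_pow_mul_log_neg {m : ℕ} (hm : 1 ≤ m) :
    (fun z : ℂ => z ^ m * log (-z)) =O[𝓝[cutPlane] 0] (fun _ => (1 : ℂ)) := by
  refine Asymptotics.IsBigO.of_bound (1 + Real.pi) ?_
  filter_upwards [self_mem_nhdsWithin,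
    mem_nhdsWithin_of_mem_nhds (Metric.closedBall_mem_nhds (0 : ℂ) one_pos)] with z hz hz1
  have hz0 : 0 < ‖z‖ := norm_pos_iff.2 (ne_zero_of_mem_cutPlane hz)
  rw [mem_closedBall_zero_iff] at hz1
  have h1 := norm_log_le (z := -z)
  rw [norm_neg] at h1
  have h2 := (Real.abs_log_mul_self_lt ‖z‖ hz0 hz1).le
  rw [abs_mul, abs_of_pos hz0] at h2
  rw [norm_mul, norm_pow, norm_one, mul_one]
  calc ‖z‖ ^ m * ‖log (-z)‖ ≤ ‖z‖ * (|Real.log ‖z‖| + Real.pi) := by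
        gcongr
        exact pow_le_of_le_one hz0.le hz1 (by omega)
    _ = |Real.log ‖z‖| * ‖z‖ + ‖z‖ * Real.pi := by ring
    _ ≤ 1 + 1 * Real.pi := by gcongr
    _ = 1 + Real.pi := by ring

lemma isPowGermAddBounded_expTransform {α : ℂ} (hα : ∀ k : ℕ, α ≠ -(k : ℂ)) :
    IsPowGermAddBounded α (expTransform α) := by
  have hβ : ∀ k : ℕ, α ≠ -((k : ℂ) + 1) := fun k h => hα (k + 1) (by push_cast; exact h)
  have hbdd : ∀ {A : ℂ → ℂ}, Differentiable ℂ A → A =O[𝓝[cutPlane] 0] (fun _ => (1 : ℂ)) :=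
    fun hA => ((hA.continuous.tendsto 0).mono_left nhdsWithin_le_nhds).isBigO_one ℂ
  have hexp : Differentiable ℂ fun z : ℂ => exp (-z) := by fun_prop
  by_cases hn : ∃ m : ℕ, α = m
  · obtain ⟨m, rfl⟩ := hn
    -- Here α ≠ 0 is essential: z^m log(-z) is bounded near 0 only for m ≥ 1.
    have hm : 1 ≤ m := by
      rcases m with _ | m
      · exact absurd (by simp) (hα 0)
      · omega
    obtain ⟨K, A, hA, hG⟩ := exists_expTransform_natCast_eq m
    refine ⟨fun z => exp (-z) * K, (hexp.mul_const K).analyticAt 0, ?_⟩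
    have h := (hbdd hexp).mul ((hbdd hA).sub (isBigO_pow_mul_log_neg hm))
    rw [mul_one] at h
    refine h.congr' ?_ EventuallyEq.rfl
    filter_upwards [self_mem_nhdsWithin] with z hz
    rw [hG z hz]
    ring
  · push Not at hn
    obtain ⟨K, A, hA, hG⟩ := exists_expTransform_eq_of_ne_natCast hβ hn
    refine ⟨fun z => exp (-z) * K, (hexp.mul_const K).analyticAt 0, ?_⟩
    have h := (hbdd hexp).mul (hbdd hA)
    rw [mul_one] at h
    refine h.congr' ?_ EventuallyEq.rfl
    filter_upwards [self_mem_nhdsWithin] with z hz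
    rw [hG z hz]
    ring

/-! ### Behaviour at infinity -/

lemma exists_rpow_mul_exp_neg_le {a : ℝ} (ha : 0 ≤ a) :
    ∃ M : ℝ, ∀ t : ℝ, 0 < t → t ^ a * Real.exp (-t) ≤ M := by
  obtain ⟨N, hN⟩ := exists_nat_ge a
  refine ⟨1 + N.factorial, fun t ht => ?_⟩
  have h1 : t ^ a ≤ 1 + t ^ N := by
    rcases le_total t 1 with h | h
    · exact (Real.rpow_le_one ht.le h ha).trans (by linarith [pow_pos ht N])
    · have h2 := Real.rpow_le_rpow_of_exponent_le h hN
      rw [Real.rpow_natCast] at h2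
      linarith
  have h2 : t ^ N ≤ N.factorial * Real.exp t := by
    have h3 := Real.pow_div_factorial_le_exp t ht.le N
    rwa [div_le_iff₀ (by exact_mod_cast N.factorial_pos), mul_comm] at h3
  have h4 : Real.exp t * Real.exp (-t) = 1 := by rw [← Real.exp_add]; simp
  have h5 : Real.exp (-t) ≤ 1 := Real.exp_le_one_iff.2 (by linarith)
  calc t ^ a * Real.exp (-t) ≤ (1 + N.factorial * Real.exp t) * Real.exp (-t) := by
        gcongr
        linarith
    _ = Real.exp (-t) + N.factorial * (Real.exp t * Real.exp (-t)) := by ring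
    _ ≤ 1 + N.factorial := by rw [h4]; linarith

lemma exists_norm_weight_le {β : ℂ} (hβ : 0 ≤ β.re) :
    ∃ M : ℝ, ∀ t : ℝ, 0 < t → ‖weight β t‖ ≤ M := by
  obtain ⟨M, hM⟩ := exists_rpow_mul_exp_neg_le hβ
  exact ⟨M, fun t ht => (norm_weight β ht).trans_le (hM t ht)⟩

/-- For Re β ≥ 1 the derivative βw_{β-1} - w_β is bounded on the half-line, so the mean value
inequality applies. -/
lemma exists_norm_weight_sub_le {β : ℂ} (hβ : 1 ≤ β.re) :
    ∃ M : ℝ, ∀ s t : ℝ, 0 < s → 0 < t → ‖weight β t - weight β s‖ ≤ M * |t - s| := by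
  obtain ⟨M₁, hM₁⟩ := exists_norm_weight_le (β := β - 1) (by simpa using hβ)
  obtain ⟨M₂, hM₂⟩ := exists_norm_weight_le (β := β) (by linarith)
  refine ⟨‖β‖ * M₁ + M₂, fun s t hs ht => ?_⟩
  refine (convex_Ioi (0 : ℝ)).norm_image_sub_le_of_norm_hasDerivWithin_le
    (fun u hu => (hasDerivAt_weight β hu).hasDerivWithinAt) (fun u hu => ?_) hs ht
  refine (norm_sub_le _ _).trans ?_
  rw [norm_mul]
  gcongr
  · exact hM₁ u hu
  · exact hM₂ u hu

/-- The interval is symmetric about Re z, so the real parts of the primitive log(t - z) cancel at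
the ends and only two arguments remain. The bound is therefore uniform as z approaches the axis. -/
lemma norm_integral_inv_sub_le {z : ℂ} (hz : z.im ≠ 0) (r : ℝ) :
    ‖∫ t in (z.re - r)..(z.re + r), ((t : ℂ) - z)⁻¹‖ ≤ 2 * Real.pi := by
  have hne : ∀ t : ℝ, (t : ℂ) - z ∈ slitPlane := fun t =>
    mem_slitPlane_iff.2 (Or.inr (by simpa using hz))
  have hd : ∀ t ∈ Set.uIcc (z.re - r) (z.re + r),
      HasDerivAt (fun t : ℝ => log ((t : ℂ) - z)) ((t : ℂ) - z)⁻¹ t := by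
    intro t _
    have h1 : HasDerivAt (fun t : ℝ => (t : ℂ) - z) 1 t := by
      simpa using ((hasDerivAt_id (t : ℂ)).comp_ofReal).sub_const z
    exact (h1.clog_real (hne t)).congr_deriv (one_div _)
  have hc : IntervalIntegrable (fun t : ℝ => ((t : ℂ) - z)⁻¹) volume (z.re - r) (z.re + r) := by
    refine ContinuousOn.intervalIntegrable (ContinuousOn.inv₀ (by fun_prop) fun t _ => ?_)
    exact slitPlane_ne_zero (hne t)
  rw [intervalIntegral.integral_eq_sub_of_hasDerivAt hd hc]
  refine (Complex.norm_le_abs_re_add_abs_im _).trans ?_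
  have h1 : ‖((z.re + r : ℝ) : ℂ) - z‖ = ‖((z.re - r : ℝ) : ℂ) - z‖ := by
    rw [Complex.norm_def, Complex.norm_def]
    congr 1
    simp [normSq_apply]
  rw [sub_re, log_re, log_re, h1, sub_self, abs_zero, zero_add, sub_im, log_im, log_im]
  refine (abs_sub _ _).trans ?_
  have h2 := abs_arg_le_pi (((z.re + r : ℝ) : ℂ) - z)
  have h3 := abs_arg_le_pi (((z.re - r : ℝ) : ℂ) - z)
  linarith

lemma norm_setIntegral_div_le {β : ℂ} (hβ : -1 < β.re) {s : Set ℝ} (hs : MeasurableSet s)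
    (hs0 : s ⊆ Set.Ioi 0) {z : ℂ} {r : ℝ} (hr : 0 < r) (hle : ∀ t ∈ s, r ≤ ‖(t : ℂ) - z‖) :
    ‖∫ t in s, weight β t / ((t : ℂ) - z)‖ ≤ r⁻¹ * ∫ t in Set.Ioi (0 : ℝ), ‖weight β t‖ := by
  have hi := (integrableOn_weight hβ).norm
  have h1 : ‖∫ t in s, weight β t / ((t : ℂ) - z)‖ ≤ ∫ t in s, r⁻¹ * ‖weight β t‖ := by
    refine norm_integral_le_of_norm_le ((IntegrableOn.mono_set hi hs0).const_mul _) ?_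
    refine (ae_restrict_iff' hs).2 (ae_of_all _ fun t ht => ?_)
    rw [norm_div, div_eq_inv_mul]
    gcongr
    exact hle t ht
  refine h1.trans ?_
  rw [integral_const_mul]
  exact mul_le_mul_of_nonneg_left
    (setIntegral_mono_set hi (ae_of_all _ fun t => norm_nonneg _) hs0.eventuallyLE)
    (inv_nonneg.2 hr.le)

/-- If z is at distance at least 1/2 from the half-line, the integral is estimated directly.
Otherwise x = Re z > 1, and on the unit interval around x the weight is split as (w(t) - w(x)) +
w(x): the Lipschitz bound controls the first part and `norm_integral_inv_sub_le` the second. Hence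
the constant does not depend on the distance to the cut. -/
lemma exists_norm_expTransform_le {β : ℂ} (hβ : 1 ≤ β.re) :
    ∃ C : ℝ, ∀ z ∈ cutPlane, 2 ≤ ‖z‖ → ‖expTransform β z‖ ≤ C := by
  obtain ⟨M, hM⟩ := exists_norm_weight_le (β := β) (by linarith)
  obtain ⟨L, hL⟩ := exists_norm_weight_sub_le hβ
  have hβ' : -1 < β.re := by linarith
  set B := (1 / 2 : ℝ)⁻¹ * ∫ t in Set.Ioi (0 : ℝ), ‖weight β t‖ with hB
  have hM0 : 0 ≤ M := (norm_nonneg _).trans (hM 1 one_pos)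
  have hL0 : 0 ≤ L := by
    have h := (norm_nonneg _).trans (hL 1 2 one_pos two_pos)
    norm_num at h
    exact h
  refine ⟨(L + M * (2 * Real.pi)) + B, fun z hz hz2 => ?_⟩
  rw [expTransform_eq_integral hβ' hz]
  by_cases hfar : ∀ t : ℝ, 0 < t → 1 / 2 ≤ ‖(t : ℂ) - z‖
  · have h := norm_setIntegral_div_le hβ' measurableSet_Ioi subset_rfl (by norm_num) hfar
    refine h.trans ?_
    rw [← hB]
    have : 0 ≤ L + M * (2 * Real.pi) := by positivity
    linarith
  · push Not at hfar
    obtain ⟨t₀, ht₀, hlt⟩ := hfar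
    have ht1 : 3 / 2 < t₀ := by
      have h1 : ‖z‖ ≤ ‖(t₀ : ℂ)‖ + ‖(t₀ : ℂ) - z‖ := by
        have := norm_sub_le (t₀ : ℂ) ((t₀ : ℂ) - z)
        rwa [sub_sub_cancel] at this
      rw [Complex.norm_real, Real.norm_eq_abs, abs_of_pos ht₀] at h1
      linarith
    set x := z.re with hx
    have hx1 : 1 < x := by
      have h1 := (Complex.abs_re_le_norm ((t₀ : ℂ) - z)).trans_lt hlt
      simp only [sub_re, ofReal_re] at h1
      have := (abs_lt.1 h1).2
      linarith
    have him : z.im ≠ 0 := fun h => hz ⟨by linarith, h⟩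
    have hre : ∀ t : ℝ, |t - x| ≤ ‖(t : ℂ) - z‖ := fun t => by
      simpa using Complex.abs_re_le_norm ((t : ℂ) - z)
    have hab : x - 1 / 2 ≤ x + 1 / 2 := by linarith
    have hsub : Set.Ioc (x - 1 / 2) (x + 1 / 2) ⊆ Set.Ioi (0 : ℝ) := fun t ht =>
      lt_trans (by linarith) ht.1
    have hi := integrableOn_div le_rfl (integrableOn_weight hβ') hz
    rw [← integral_inter_add_sdiff (measurableSet_Ioc (a := x - 1 / 2) (b := x + 1 / 2)) hi,
      Set.inter_eq_right.2 hsub]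
    refine (norm_add_le _ _).trans (add_le_add ?_ ?_)
    · have hinv : IntervalIntegrable (fun t : ℝ => ((t : ℂ) - z)⁻¹) volume
          (x - 1 / 2) (x + 1 / 2) := by
        refine ContinuousOn.intervalIntegrable (ContinuousOn.inv₀ (by fun_prop) fun t _ h => ?_)
        exact him (by simpa using congrArg Complex.im h)
      have hwi : IntervalIntegrable (fun t : ℝ => weight β t / ((t : ℂ) - z)) volume
          (x - 1 / 2) (x + 1 / 2) :=
        (intervalIntegrable_iff_integrableOn_Ioc_of_le hab).2 (hi.mono_set hsub)
      have h1 : ∫ t in (x - 1 / 2)..(x + 1 / 2), weight β t / ((t : ℂ) - z) =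
          (∫ t in (x - 1 / 2)..(x + 1 / 2),
            (weight β t / ((t : ℂ) - z) - weight β x * ((t : ℂ) - z)⁻¹)) +
          weight β x * ∫ t in (x - 1 / 2)..(x + 1 / 2), ((t : ℂ) - z)⁻¹ := by
        rw [intervalIntegral.integral_sub hwi (hinv.const_mul _),
          intervalIntegral.integral_const_mul]
        ring
      rw [← intervalIntegral.integral_of_le hab, h1]
      refine (norm_add_le _ _).trans (add_le_add ?_ ?_)
      · have h2 := intervalIntegral.norm_integral_le_of_norm_le_const (C := L)
          (a := x - 1 / 2) (b := x + 1 / 2)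
          (f := fun t : ℝ => weight β t / ((t : ℂ) - z) - weight β x * ((t : ℂ) - z)⁻¹) (by
            intro t ht
            rw [Set.uIoc_of_le hab] at ht
            have hne : (t : ℂ) - z ≠ 0 := ofReal_sub_ne_zero hz (le_of_lt (hsub ht))
            rw [← div_eq_mul_inv, ← sub_div, norm_div, div_le_iff₀ (norm_pos_iff.2 hne)]
            refine (hL x t (by linarith) (hsub ht)).trans ?_
            gcongr
            exact hre t)
        refine h2.trans (le_of_eq ?_)
        rw [show x + 1 / 2 - (x - 1 / 2) = 1 by ring]
        simp
      · rw [norm_mul]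
        gcongr
        · exact hM x (by linarith)
        · exact norm_integral_inv_sub_le him _
    · refine norm_setIntegral_div_le hβ' (measurableSet_Ioi.diff measurableSet_Ioc)
        Set.sdiff_subset (by norm_num) fun t ht => le_trans ?_ (hre t)
      by_contra! h
      rw [abs_lt] at h
      exact ht.2 ⟨by linarith [h.1], by linarith [h.2]⟩

/-- The neighbourhoods of infinity in the slit plane. -/
abbrev cutInfty : Filter ℂ := Bornology.cobounded ℂ ⊓ 𝓟 cutPlane

lemma eventually_mem_cutInfty : ∀ᶠ z in cutInfty, z ∈ cutPlane :=
  mem_inf_of_right (mem_principal_self _)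

lemma eventually_norm_ge_cutInfty (r : ℝ) : ∀ᶠ z in cutInfty, r ≤ ‖z‖ :=
  (tendsto_norm_cobounded_atTop.eventually_ge_atTop r).filter_mono inf_le_left

lemma isBigO_inv_one : (fun z : ℂ => z⁻¹) =O[cutInfty] (fun _ => (1 : ℂ)) := by
  refine Asymptotics.IsBigO.of_bound 1 ?_
  filter_upwards [eventually_norm_ge_cutInfty 1] with z hz
  rw [norm_inv, norm_one, mul_one]
  exact inv_le_one_of_one_le₀ hz

lemma isBigO_one_expTransform {β : ℂ} (hβ : ∀ k : ℕ, β ≠ -((k : ℂ) + 1)) :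
    expTransform β =O[cutInfty] (fun _ => (1 : ℂ)) := by
  obtain ⟨k, hk⟩ := exists_nat_ge (1 - β.re)
  induction k generalizing β with
  | zero =>
    obtain ⟨C, hC⟩ := exists_norm_expTransform_le (β := β) (by
      push_cast at hk
      linarith)
    refine Asymptotics.IsBigO.of_bound C ?_
    filter_upwards [eventually_mem_cutInfty, eventually_norm_ge_cutInfty 2] with z hz hz2
    simpa using hC z hz hz2
  | succ k ih =>
    have h := ih (add_one_ne hβ) (by
      push_cast at hk
      simp
      linarith)
    have h1 := isBigO_inv_one.mul (h.sub (Asymptotics.isBigO_const_const (Gamma (β + 1))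
      (one_ne_zero (α := ℂ)) cutInfty))
    rw [mul_one] at h1
    refine h1.congr' ?_ EventuallyEq.rfl
    filter_upwards [eventually_mem_cutInfty] with z hz
    rw [← mul_expTransform hβ hz, inv_mul_cancel_left₀ (ne_zero_of_mem_cutPlane hz)]

/-- Boundedness of G_{β+1} suffices, because G_β = z⁻¹(G_{β+1} - Γ(β+1)). -/
lemma isBigO_expTransform {β : ℂ} (hβ : ∀ k : ℕ, β ≠ -((k : ℂ) + 1)) :
    expTransform β =O[cutInfty] (fun z => z⁻¹) := by
  have h := (Asymptotics.isBigO_refl (fun z : ℂ => z⁻¹) cutInfty).mul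
    ((isBigO_one_expTransform (add_one_ne hβ)).sub
      (Asymptotics.isBigO_const_const (Gamma (β + 1)) (one_ne_zero (α := ℂ)) cutInfty))
  simp only [mul_one] at h
  refine h.congr' ?_ EventuallyEq.rfl
  filter_upwards [eventually_mem_cutInfty] with z hz
  rw [← mul_expTransform hβ hz, inv_mul_cancel_left₀ (ne_zero_of_mem_cutPlane hz)]

/-! ### The Cauchy transform of a polynomial -/

/-- The linear functional `∑ pᵢ Xⁱ ↦ ∑ φᵢ pᵢ` on polynomials. -/
def coeffSum (φ : ℕ → ℂ) : ℂ[X] →ₗ[ℂ] ℂ := Polynomial.lsum fun i => φ i • LinearMap.id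

lemma coeffSum_monomial (φ : ℕ → ℂ) (i : ℕ) (a : ℂ) : coeffSum φ (monomial i a) = φ i * a := by
  simp [coeffSum, Polynomial.lsum_apply]

/-- The moment functional `p ↦ f.p. ∫₀^∞ t^α p(t) e^(-t) dt`. -/
def moment (α : ℂ) : ℂ[X] →ₗ[ℂ] ℂ := coeffSum fun i => Gamma (α + i + 1)

lemma analyticOnNhd_eval (p : ℂ[X]) (s : Set ℂ) : AnalyticOnNhd ℂ (fun t => p.eval t) s :=
  fun t _ => p.differentiable.analyticAt t

lemma integrableOn_polynomial_mul {f : ℂ → ℂ} {ξ : ℝ} (hξ : 0 < ξ)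
    (hfi : ∀ γ : ℂ, IntegrableOn (fun t : ℝ => (t : ℂ) ^ γ * f t) (Set.Ioi ξ)) (β : ℂ)
    (p : ℂ[X]) : IntegrableOn (fun t : ℝ => (t : ℂ) ^ β * (p.eval (t : ℂ) * f t)) (Set.Ioi ξ) := by
  induction p using Polynomial.induction_on' with
  | add p q hp hq =>
    refine IntegrableOn.congr_fun (hp.add hq) (fun t _ => ?_) measurableSet_Ioi
    simp only [Pi.add_apply, eval_add]
    ring
  | monomial i a =>
    refine IntegrableOn.congr_fun ((hfi (β + i)).const_mul a) (fun t ht => ?_) measurableSet_Ioi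
    have ht0 : (t : ℂ) ≠ 0 := by exact_mod_cast (hξ.trans ht).ne'
    simp only [eval_monomial]
    rw [cpow_add _ _ ht0, cpow_natCast]
    ring

lemma finitePart_pow_mul {f : ℂ → ℂ} {ξ : ℝ} (hξ : 0 < ξ)
    (hf : AnalyticOnNhd ℂ f (Metric.closedBall 0 ξ))
    (hfi : ∀ γ : ℂ, IntegrableOn (fun t : ℝ => (t : ℂ) ^ γ * f t) (Set.Ioi ξ)) {β : ℂ}
    (hβ : ∀ k : ℕ, β ≠ -((k : ℂ) + 1)) (i : ℕ) :
    finitePart β (fun t => t ^ i * f t) = finitePart (β + i) f := by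
  induction i generalizing β with
  | zero => simp
  | succ i ih =>
    have h := finitePart_id_mul hβ hξ (f := fun t => t ^ i * f t)
      ((analyticOnNhd_id.pow i).mul hf)
      (by simpa using integrableOn_polynomial_mul hξ hfi (β + 1) (X ^ i))
    rw [ih (add_one_ne hβ)] at h
    have he : (fun t : ℂ => t ^ (i + 1) * f t) = fun t => t * (t ^ i * f t) := by
      ext t
      ring
    rw [he, h]
    push_cast
    ring_nf

lemma finitePart_polynomial_mul {f : ℂ → ℂ} {ξ : ℝ} (hξ : 0 < ξ)
    (hf : AnalyticOnNhd ℂ f (Metric.closedBall 0 ξ))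
    (hfi : ∀ γ : ℂ, IntegrableOn (fun t : ℝ => (t : ℂ) ^ γ * f t) (Set.Ioi ξ)) {β : ℂ}
    (hβ : ∀ k : ℕ, β ≠ -((k : ℂ) + 1)) (p : ℂ[X]) :
    finitePart β (fun t => p.eval t * f t) = coeffSum (fun i => finitePart (β + i) f) p := by
  induction p using Polynomial.induction_on' with
  | add p q hp hq =>
    rw [map_add, ← hp, ← hq, ← finitePart_add hβ hξ ((analyticOnNhd_eval p _).mul hf)
      ((analyticOnNhd_eval q _).mul hf) (integrableOn_polynomial_mul hξ hfi β p)
      (integrableOn_polynomial_mul hξ hfi β q)]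
    simp only [eval_add, add_mul]
  | monomial i a =>
    rw [coeffSum_monomial, ← finitePart_pow_mul hξ hf hfi hβ, mul_comm,
      ← finitePart_const_mul (f := fun t => t ^ i * f t) hβ a hξ ((analyticOnNhd_id.pow i).mul hf)
        (by simpa using integrableOn_polynomial_mul hξ hfi β (X ^ i))]
    simp only [eval_monomial, mul_assoc]

lemma cauchyTransform_eq {α : ℂ} (hα : ∀ k : ℕ, α ≠ -((k : ℂ) + 1)) (p : ℂ[X]) {z : ℂ}
    (hz : z ∈ cutPlane) : cauchyTransform α p z =
      (2 * Real.pi * I)⁻¹ * coeffSum (fun i => expTransform (α + i) z) p := by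
  have hz0 : 0 < ‖z‖ := norm_pos_iff.2 (ne_zero_of_mem_cutPlane hz)
  simp only [cauchyTransform, expTransform, mul_div_assoc]
  rw [finitePart_polynomial_mul (half_pos hz0) (analyticOnNhd_exp_neg_div (half_lt_self hz0))
    (fun γ => integrableOn_cpow_mul_exp_neg_div γ (half_pos hz0) hz) hα]

section

variable {α : ℂ} (hα : ∀ k : ℕ, α ≠ -((k : ℂ) + 1))
include hα

lemma cauchyTransform_add (p q : ℂ[X]) {z : ℂ} (hz : z ∈ cutPlane) :
    cauchyTransform α (p + q) z = cauchyTransform α p z + cauchyTransform α q z := by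
  simp only [cauchyTransform_eq hα _ hz, map_add, mul_add]

lemma cauchyTransform_monomial (i : ℕ) (a : ℂ) {z : ℂ} (hz : z ∈ cutPlane) :
    cauchyTransform α (monomial i a) z =
      (2 * Real.pi * I)⁻¹ * a * expTransform (α + i) z := by
  rw [cauchyTransform_eq hα _ hz, coeffSum_monomial]
  ring

lemma analyticOnNhd_cauchyTransform (p : ℂ[X]) :
    AnalyticOnNhd ℂ (cauchyTransform α p) cutPlane := by
  induction p using Polynomial.induction_on' with
  | add p q hp hq =>
    exact (hp.add hq).congr isOpen_cutPlane
      fun z hz => (cauchyTransform_add hα p q hz).symm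
  | monomial i a =>
    exact (analyticOnNhd_const.mul (analyticOnNhd_expTransform (add_natCast_ne hα i))).congr
      isOpen_cutPlane fun z hz => (cauchyTransform_monomial hα i a hz).symm

lemma exists_tendsto_cauchyTransform (p : ℂ[X]) {x : ℝ} (hx : 0 < x) :
    ∃ Lp Lm : ℂ, Tendsto (cauchyTransform α p) (𝓝[{z | 0 < z.im}] (x : ℂ)) (𝓝 Lp) ∧
      Tendsto (cauchyTransform α p) (𝓝[{z | z.im < 0}] (x : ℂ)) (𝓝 Lm) ∧
      Lp = Lm + p.eval (x : ℂ) * weight α x := by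
  induction p using Polynomial.induction_on' with
  | add p q hp hq =>
    obtain ⟨Pp, Pm, h1, h2, h3⟩ := hp
    obtain ⟨Qp, Qm, h4, h5, h6⟩ := hq
    refine ⟨Pp + Qp, Pm + Qm, (h1.add h4).congr' ?_, (h2.add h5).congr' ?_, ?_⟩
    · filter_upwards [eventually_mem_cutPlane_above x] with z hz
      exact (cauchyTransform_add hα p q hz).symm
    · filter_upwards [eventually_mem_cutPlane_below x] with z hz
      exact (cauchyTransform_add hα p q hz).symm
    · rw [h3, h6, eval_add]
      ring
  | monomial i a =>
    obtain ⟨Lp, Lm, h1, h2, h3⟩ := exists_tendsto_expTransform (add_natCast_ne hα i) hx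
    refine ⟨_, _, (h1.const_mul ((2 * Real.pi * I)⁻¹ * a)).congr' ?_,
      (h2.const_mul ((2 * Real.pi * I)⁻¹ * a)).congr' ?_, ?_⟩
    · filter_upwards [eventually_mem_cutPlane_above x] with z hz
      exact (cauchyTransform_monomial hα i a hz).symm
    · filter_upwards [eventually_mem_cutPlane_below x] with z hz
      exact (cauchyTransform_monomial hα i a hz).symm
    · have h4 : (2 * Real.pi * I : ℂ) ≠ 0 := two_pi_I_ne_zero
      rw [weight_add_natCast α i hx] at h3
      rw [sub_eq_iff_eq_add.1 h3, eval_monomial]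
      field_simp
      ring

lemma isBigO_cauchyTransform (p : ℂ[X]) :
    cauchyTransform α p =O[cutInfty] (fun z => z⁻¹) := by
  induction p using Polynomial.induction_on' with
  | add p q hp hq =>
    refine (hp.add hq).congr' ?_ EventuallyEq.rfl
    filter_upwards [eventually_mem_cutInfty] with z hz
    exact (cauchyTransform_add hα p q hz).symm
  | monomial i a =>
    refine ((isBigO_expTransform (add_natCast_ne hα i)).const_mul_left
      ((2 * Real.pi * I)⁻¹ * a)).congr' ?_ EventuallyEq.rfl
    filter_upwards [eventually_mem_cutInfty] with z hz
    exact (cauchyTransform_monomial hα i a hz).symm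

lemma mul_cauchyTransform (p : ℂ[X]) {z : ℂ} (hz : z ∈ cutPlane) :
    z * cauchyTransform α p z =
      cauchyTransform α (X * p) z - (2 * Real.pi * I)⁻¹ * moment α p := by
  induction p using Polynomial.induction_on' with
  | add p q hp hq =>
    rw [cauchyTransform_add hα p q hz, mul_add, hp, hq, mul_add, cauchyTransform_add hα _ _ hz,
      map_add]
    ring
  | monomial i a =>
    rw [X_mul_monomial, cauchyTransform_monomial hα _ _ hz, cauchyTransform_monomial hα _ _ hz,
      moment, coeffSum_monomial]
    have h := mul_expTransform (add_natCast_ne hα i) hz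
    push_cast
    rw [← add_assoc]
    linear_combination ((2 * Real.pi * I)⁻¹ * a) * h

/-- Each factor z moved inside the transform costs one moment of X^j p. Orthogonality removes these,
and so the decay improves to O(z^(-n-1)). -/
lemma pow_mul_cauchyTransform {p : ℂ[X]} {n : ℕ} (h : ∀ j < n, moment α (X ^ j * p) = 0) {z : ℂ}
    (hz : z ∈ cutPlane) : z ^ n * cauchyTransform α p z = cauchyTransform α (X ^ n * p) z := by
  induction n with
  | zero => simp
  | succ n ih =>
    have h1 := mul_cauchyTransform hα (X ^ n * p) hz
    rw [h n n.lt_succ_self, mul_zero, sub_zero, ← mul_assoc, ← pow_succ'] at h1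
    rw [← h1, ← ih fun j hj => h j (hj.trans n.lt_succ_self)]
    ring

end

lemma isPowGermAddBounded_cauchyTransform {α : ℂ} (hα : ∀ k : ℕ, α ≠ -(k : ℂ)) (p : ℂ[X]) :
    IsPowGermAddBounded α (cauchyTransform α p) := by
  have hβ : ∀ k : ℕ, α ≠ -((k : ℂ) + 1) := fun k h => hα (k + 1) (by push_cast; exact h)
  have hcongr : ∀ {f g : ℂ → ℂ}, IsPowGermAddBounded α f → (∀ z ∈ cutPlane, g z = f z) →
      IsPowGermAddBounded α g := by
    rintro f g ⟨f₀, hf₀, hf⟩ h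
    refine ⟨f₀, hf₀, hf.congr' ?_ EventuallyEq.rfl⟩
    filter_upwards [self_mem_nhdsWithin] with z hz
    rw [h z hz]
  induction p using Polynomial.induction_on' with
  | add p q hp hq => exact hcongr (hp.add hq) fun z hz => cauchyTransform_add hβ p q hz
  | monomial i a =>
    have h1 : IsPowGermAddBounded α (expTransform (α + i)) :=
      (isPowGermAddBounded_expTransform fun k h => hα (k + i) (by
        push_cast
        linear_combination h)).of_add_natCast
    exact hcongr (h1.mul_left (a := fun _ => (2 * Real.pi * I)⁻¹ * a) analyticAt_const)
      fun z hz => cauchyTransform_monomial hβ i a hz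

/-! ### Laguerre polynomials -/

/-- Times t^α e^(-t), the polynomial is the derivative of t^(α+1) e^(-t) p(t), whose finite-part
integral vanishes. On monomials this is Γ(s+1) = sΓ(s). -/
lemma moment_raise (α : ℂ) (hα : ∀ k : ℕ, α ≠ -((k : ℂ) + 1)) (p : ℂ[X]) :
    moment α ((C (α + 1) - X) * p + X * derivative p) = 0 := by
  induction p using Polynomial.induction_on' with
  | add p q hp hq =>
    have h : (C (α + 1) - X) * (p + q) + X * derivative (p + q) =
        ((C (α + 1) - X) * p + X * derivative p) + ((C (α + 1) - X) * q + X * derivative q) := by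
      rw [derivative_add]
      ring
    rw [h, map_add, hp, hq, add_zero]
  | monomial i a =>
    have h1 : X * derivative (monomial i a) = monomial i (a * i) := by
      rcases i with _ | i
      · simp
      · rw [derivative_monomial, X_mul_monomial, Nat.add_sub_cancel]
    have h0 : α + i + 1 ≠ 0 := fun h => hα i (by linear_combination h)
    rw [h1, sub_mul, C_mul_monomial, X_mul_monomial, map_add, map_sub, moment, coeffSum_monomial,
      coeffSum_monomial, coeffSum_monomial]
    have h2 := Complex.Gamma_add_one _ h0
    push_cast
    rw [← add_assoc, h2]
    ring

lemma X_mul_derivative_X_pow_mul (j : ℕ) (p : ℂ[X]) :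
    X * derivative (X ^ j * p) = C (j : ℂ) * (X ^ j * p) + X ^ j * (X * derivative p) := by
  rcases j with _ | j
  · simp
  · rw [derivative_mul, derivative_X_pow, Nat.add_sub_cancel]
    ring

/-- One step of the recursion is the operator of `moment_raise` applied to X^j times the polynomial,
up to a scalar: (m - k + α) - (α + 1) - j, where j comes from differentiating X^j. -/
lemma moment_laguerreAux_succ {α : ℂ} (hα : ∀ k : ℕ, α ≠ -((k : ℂ) + 1)) (m k j : ℕ) :
    moment α (X ^ j * laguerreAux α m (k + 1)) =
      ((m : ℂ) - k - 1 - j) * moment α (X ^ j * laguerreAux α m k) := by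
  have h : X ^ j * laguerreAux α m (k + 1) =
      ((C (α + 1) - X) * (X ^ j * laguerreAux α m k) +
        X * derivative (X ^ j * laguerreAux α m k)) +
      ((m : ℂ) - k - 1 - j) • (X ^ j * laguerreAux α m k) := by
    rw [laguerreAux, X_mul_derivative_X_pow_mul, smul_eq_C_mul]
    simp only [map_add, map_sub, map_one]
    ring
  rw [h, map_add, moment_raise α hα, zero_add, map_smul, smul_eq_mul]

lemma moment_laguerreAux {α : ℂ} (hα : ∀ k : ℕ, α ≠ -((k : ℂ) + 1)) (m k j : ℕ) :
    moment α (X ^ j * laguerreAux α m k) =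
      (∏ i ∈ Finset.range k, ((m : ℂ) - i - 1 - j)) * Gamma (α + j + 1) := by
  induction k with
  | zero =>
    rw [laguerreAux, mul_one, X_pow_eq_monomial, moment, coeffSum_monomial]
    simp
  | succ k ih =>
    rw [moment_laguerreAux_succ hα, ih, Finset.prod_range_succ]
    ring

lemma moment_monicLaguerre_of_lt {α : ℂ} (hα : ∀ k : ℕ, α ≠ -((k : ℂ) + 1)) {m j : ℕ}
    (hj : j < m) : moment α (X ^ j * monicLaguerre α m) = 0 := by
  have h : X ^ j * monicLaguerre α m = ((-1 : ℂ) ^ m) • (X ^ j * laguerreAux α m m) := by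
    rw [monicLaguerre, laguerre, smul_eq_C_mul]
    ring
  -- The factor m - i - 1 - j is zero at i = m - 1 - j, an index in the range exactly because j < m.
  rw [h, map_smul, moment_laguerreAux hα, Finset.prod_eq_zero (i := m - 1 - j)
    (Finset.mem_range.2 (by omega)), zero_mul, smul_zero]
  have h1 : m - 1 - j + 1 + j = m := by omega
  have h2 : (((m - 1 - j + 1 + j : ℕ)) : ℂ) = m := by rw [h1]
  push_cast at h2
  linear_combination -h2

lemma moment_monicLaguerre_self {α : ℂ} (hα : ∀ k : ℕ, α ≠ -((k : ℂ) + 1)) (m : ℕ) :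
    moment α (X ^ m * monicLaguerre α m) = (m.factorial : ℂ) * Gamma (α + m + 1) := by
  have h : X ^ m * monicLaguerre α m = ((-1 : ℂ) ^ m) • (X ^ m * laguerreAux α m m) := by
    rw [monicLaguerre, laguerre, smul_eq_C_mul]
    ring
  -- The factors are -(i + 1); their sign cancels the (-1)^m of the monic normalisation.
  have h1 : ∏ i ∈ Finset.range m, ((m : ℂ) - i - 1 - m) = (-1) ^ m * (m.factorial : ℂ) := by
    rw [← Finset.prod_range_add_one_eq_factorial]
    push_cast
    rw [← Finset.card_range m, ← Finset.prod_const, Finset.card_range, ← Finset.prod_mul_distrib]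
    refine Finset.prod_congr rfl fun i _ => ?_
    ring
  rw [h, map_smul, moment_laguerreAux hα, h1, smul_eq_mul, ← mul_assoc, ← mul_assoc, ← mul_pow]
  simp

lemma coeff_laguerreAux (α : ℂ) (m k : ℕ) :
    (laguerreAux α m k).coeff k = (-1) ^ k ∧ ∀ j, k < j → (laguerreAux α m k).coeff j = 0 := by
  induction k with
  | zero =>
    refine ⟨by simp [laguerreAux], fun j hj => ?_⟩
    rw [laguerreAux, coeff_one, if_neg hj.ne']
  | succ k ih =>
    have h : ∀ j, (laguerreAux α m (k + 1)).coeff (j + 1) =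
        ((m : ℂ) - k + α) * (laguerreAux α m k).coeff (j + 1) - (laguerreAux α m k).coeff j +
          (laguerreAux α m k).coeff (j + 1) * (j + 1) := by
      intro j
      rw [laguerreAux, coeff_add, sub_mul, coeff_sub, coeff_C_mul, coeff_X_mul, coeff_X_mul,
        coeff_derivative]
    refine ⟨?_, fun j hj => ?_⟩
    · rw [h, ih.1, ih.2 _ k.lt_succ_self]
      ring
    · obtain ⟨j, rfl⟩ : ∃ i, j = i + 1 := ⟨j - 1, by omega⟩
      rw [h, ih.2 j (by omega), ih.2 (j + 1) (by omega)]
      ring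

lemma natDegree_monicLaguerre_le (α : ℂ) (m : ℕ) : (monicLaguerre α m).natDegree ≤ m := by
  refine natDegree_le_iff_coeff_eq_zero.2 fun j hj => ?_
  rw [monicLaguerre, coeff_C_mul, laguerre, (coeff_laguerreAux α m m).2 j hj, mul_zero]

lemma coeff_monicLaguerre_self (α : ℂ) (m : ℕ) : (monicLaguerre α m).coeff m = 1 := by
  rw [monicLaguerre, coeff_C_mul, laguerre, (coeff_laguerreAux α m m).1, ← mul_pow]
  simp

/-! ### Polynomials at infinity -/

lemma isBigO_eval_mul_inv_pow {p : ℂ[X]} {m : ℕ} (hp : p.natDegree < m) :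
    (fun z : ℂ => p.eval z * (z ^ m)⁻¹) =O[cutInfty] (fun z => z⁻¹) := by
  have h : ∀ i < m, ∀ a : ℂ, (fun z : ℂ => a * z ^ i * (z ^ m)⁻¹) =O[cutInfty] (fun z => z⁻¹) := by
    intro i hi a
    refine Asymptotics.IsBigO.of_bound ‖a‖ ?_
    filter_upwards [eventually_norm_ge_cutInfty 1] with z hz
    have hz0 : 0 < ‖z‖ := by linarith
    rw [norm_mul, norm_mul, norm_inv, norm_inv, norm_pow, norm_pow, mul_assoc]
    gcongr
    rw [← div_eq_mul_inv, div_le_iff₀ (by positivity)]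
    obtain ⟨k, rfl⟩ : ∃ k, m = i + 1 + k := ⟨m - i - 1, by omega⟩
    have h1 : (1 : ℝ) ≤ ‖z‖ ^ k := one_le_pow₀ hz
    calc ‖z‖ ^ i = ‖z‖ ^ i * 1 := by ring
      _ ≤ ‖z‖ ^ i * ‖z‖ ^ k := by gcongr
      _ = ‖z‖⁻¹ * ‖z‖ ^ (i + 1 + k) := by
        field_simp
        ring
  have h1 := Asymptotics.IsBigO.sum (s := Finset.range m) (l := cutInfty) (g := fun z : ℂ => z⁻¹)
    (A := fun i (z : ℂ) => p.coeff i * z ^ i * (z ^ m)⁻¹)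
    fun i hi => h i (Finset.mem_range.1 hi) _
  refine h1.congr_left fun z => ?_
  rw [eval_eq_sum_range' hp, Finset.sum_mul, Finset.sum_apply]

lemma isBigO_eval_mul_inv_pow_sub_one {p : ℂ[X]} {m : ℕ} (hp : p.natDegree ≤ m)
    (hc : p.coeff m = 1) :
    (fun z : ℂ => p.eval z * (z ^ m)⁻¹ - 1) =O[cutInfty] (fun z => z⁻¹) := by
  rcases m with _ | m
  · have h : p = 1 := by
      rw [eq_C_of_natDegree_le_zero hp, hc, map_one]
    simpa [h] using Asymptotics.isBigO_zero _ _
  · have h : (p - X ^ (m + 1)).natDegree < m + 1 := by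
      rw [Nat.lt_succ_iff]
      refine natDegree_le_iff_coeff_eq_zero.2 fun j hj => ?_
      rw [coeff_sub, coeff_X_pow]
      rcases eq_or_lt_of_le (Nat.succ_le_of_lt hj) with h | h
      · rw [← h, hc]
        simp
      · rw [if_neg (by omega), coeff_eq_zero_of_natDegree_lt (by omega), sub_zero]
    refine (isBigO_eval_mul_inv_pow h).congr' ?_ EventuallyEq.rfl
    filter_upwards [eventually_mem_cutInfty] with z hz
    have := pow_ne_zero (m + 1) (ne_zero_of_mem_cutPlane hz)
    rw [eval_sub, eval_pow, eval_X, sub_mul, mul_inv_cancel₀ this]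

/-! ### Removing the cut and the singularity at the origin -/

lemma dense_im_ne_zero : Dense {z : ℂ | z.im ≠ 0} := by
  intro z
  by_cases hz : z.im = 0
  · have h : ((z.re : ℝ) : ℂ) = z := Complex.ext (by simp) (by simp [hz])
    rw [← h]
    refine mem_closure_of_tendsto ((tendsto_vertical_above z.re).mono_right nhdsWithin_le_nhds) ?_
    filter_upwards [eventually_gt_atTop 0] with c hc
    simp [hc.ne']
  · exact subset_closure hz

lemma neBot_nhdsWithin_cutPlane (z : ℂ) : (𝓝[cutPlane] z).NeBot := by
  rw [← mem_closure_iff_nhdsWithin_neBot]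
  exact (dense_im_ne_zero.mono fun w hw => mem_cutPlane_of_im_ne_zero hw) z

/-- The slit plane is dense. This carries the growth hypotheses, which are given only off the cut,
over to the extended functions on the cut. -/
lemma le_of_le_on_cutPlane {u v : ℂ → ℝ} {U : Set ℂ} (hU : IsOpen U) (hu : ContinuousOn u U)
    (hv : ContinuousOn v U) (h : ∀ z ∈ cutPlane, z ∈ U → u z ≤ v z) {z : ℂ} (hz : z ∈ U) :
    u z ≤ v z := by
  have := neBot_nhdsWithin_cutPlane z
  refine le_of_tendsto_of_tendsto
    ((hu.continuousAt (hU.mem_nhds hz)).tendsto.mono_left (nhdsWithin_le_nhds (s := cutPlane)))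
    ((hv.continuousAt (hU.mem_nhds hz)).tendsto.mono_left nhdsWithin_le_nhds) ?_
  filter_upwards [self_mem_nhdsWithin, mem_nhdsWithin_of_mem_nhds (hU.mem_nhds hz)] with w hw hwU
  exact h w hw hwU

/-- A continuous function on a disk which is holomorphic off the real axis is holomorphic. -/
lemma differentiableOn_ball_of_off_real {f : ℂ → ℂ} {c : ℂ} {r : ℝ}
    (hc : ContinuousOn f (Metric.ball c r))
    (hd : ∀ z ∈ Metric.ball c r, z.im ≠ 0 → DifferentiableAt ℂ f z) :
    DifferentiableOn ℂ f (Metric.ball c r) := by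
  -- Cauchy's theorem for a rectangle needs differentiability only in the open interior, so a
  -- rectangle may have a side on the real axis. One that crosses the axis is cut along it into two,
  -- and Morera's theorem concludes.
  have hrect : ∀ (a b s t : ℝ), Set.uIcc a b ×ℂ Set.uIcc s t ⊆ Metric.ball c r →
      (0 : ℝ) ∉ Set.Ioo (min s t) (max s t) →
      (∫ x : ℝ in a..b, f (x + s * I)) - (∫ x : ℝ in a..b, f (x + t * I)) +
        I • (∫ y : ℝ in s..t, f (b + y * I)) - I • (∫ y : ℝ in s..t, f (a + y * I)) = 0 := by
    intro a b s t hsub h0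
    have h := integral_boundary_rect_eq_zero_of_continuousOn_of_differentiableOn f
      (a + s * I) (b + t * I) (by simpa using hc.mono hsub) (by
        simp only [add_re, ofReal_re, mul_re, I_re, mul_zero, ofReal_im, I_im, mul_one, sub_self,
          add_zero, add_im, mul_im, zero_add]
        intro z hz
        refine (hd z (hsub ?_) ?_).differentiableWithinAt
        · exact ⟨Set.Ioo_subset_Icc_self hz.1, Set.Ioo_subset_Icc_self hz.2⟩
        · intro h
          exact h0 (h ▸ hz.2))
    simpa using h
  refine (IsConservativeOn.isExactOn_ball hc fun z w hzw => ?_).differentiableOn Metric.isOpen_ball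
  rw [← add_eq_zero_iff_eq_neg, wedgeIntegral_add_wedgeIntegral_eq]
  change Set.uIcc z.re w.re ×ℂ Set.uIcc z.im w.im ⊆ _ at hzw
  by_cases h0 : (0 : ℝ) ∈ Set.uIcc z.im w.im
  · have hs1 : Set.uIcc z.im 0 ⊆ Set.uIcc z.im w.im := Set.uIcc_subset_uIcc_left h0
    have hs2 : Set.uIcc 0 w.im ⊆ Set.uIcc z.im w.im := Set.uIcc_subset_uIcc_right h0
    have hn1 : (0 : ℝ) ∉ Set.Ioo (min z.im 0) (max z.im 0) := fun h => by
      rcases le_total z.im 0 with h1 | h1 <;> simp [h1] at h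
    have hn2 : (0 : ℝ) ∉ Set.Ioo (min 0 w.im) (max 0 w.im) := fun h => by
      rcases le_total 0 w.im with h1 | h1 <;> simp [h1] at h
    have e1 := hrect z.re w.re z.im 0 (fun u hu => hzw ⟨hu.1, hs1 hu.2⟩) hn1
    have e2 := hrect z.re w.re 0 w.im (fun u hu => hzw ⟨hu.1, hs2 hu.2⟩) hn2
    have hint : ∀ a ∈ Set.uIcc z.re w.re, ∀ s t : ℝ, Set.uIcc s t ⊆ Set.uIcc z.im w.im →
        IntervalIntegrable (fun y : ℝ => f (a + y * I)) volume s t := by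
      intro a ha s t hst
      refine ContinuousOn.intervalIntegrable (hc.comp (by fun_prop) fun y hy => hzw ?_)
      exact ⟨by simpa using ha, by simpa using hst hy⟩
    have i1 := intervalIntegral.integral_add_adjacent_intervals
      (hint w.re Set.right_mem_uIcc _ _ hs1) (hint w.re Set.right_mem_uIcc _ _ hs2)
    have i2 := intervalIntegral.integral_add_adjacent_intervals
      (hint z.re Set.left_mem_uIcc _ _ hs1) (hint z.re Set.left_mem_uIcc _ _ hs2)
    rw [← i1, ← i2]
    simp only [smul_eq_mul] at e1 e2 ⊢
    linear_combination e1 + e2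
  · exact hrect z.re w.re z.im w.im hzw fun h => h0 (Set.Ioo_subset_Icc_self h)

/-- A holomorphic function on the slit plane whose boundary values on the two sides of the cut
agree extends to the punctured plane. -/
lemma exists_extension_across_cut {f : ℂ → ℂ} (hf : AnalyticOnNhd ℂ f cutPlane)
    (hlim : ∀ x : ℝ, 0 < x → ∃ L : ℂ, Tendsto f (𝓝[{z | 0 < z.im}] (x : ℂ)) (𝓝 L) ∧
      Tendsto f (𝓝[{z | z.im < 0}] (x : ℂ)) (𝓝 L)) :
    ∃ g : ℂ → ℂ, DifferentiableOn ℂ g {0}ᶜ ∧ Set.EqOn g f cutPlane := by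
  -- Extension from the non-real points: near x > 0 this set is the union of the two half-planes in
  -- which the one-sided limits are taken.
  set A : Set ℂ := {z | z.im ≠ 0} with hA
  have hAeq : A = {z | z.im < 0} ∪ {z | 0 < z.im} := by
    ext z
    exact lt_or_lt_iff_ne.symm
  have hlimc : ∀ z ∈ cutPlane, Tendsto f (𝓝[A] z) (𝓝 (f z)) := fun z hz =>
    (hf z hz).continuousAt.tendsto.mono_left nhdsWithin_le_nhds
  have heq : Set.EqOn (extendFrom A f) f cutPlane := fun z hz =>
    extendFrom_eq (dense_im_ne_zero z) (hlimc z hz)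
  have hcont : ContinuousOn (extendFrom A f) {0}ᶜ := by
    refine continuousOn_extendFrom (fun z _ => dense_im_ne_zero z) fun z hz => ?_
    by_cases hzc : z ∈ cutPlane
    · exact ⟨_, hlimc z hzc⟩
    · have h1 : 0 ≤ z.re ∧ z.im = 0 := not_not.1 hzc
      have h2 : ((z.re : ℝ) : ℂ) = z := Complex.ext (by simp) (by simp [h1.2])
      have h3 : 0 < z.re := lt_of_le_of_ne h1.1 fun h => hz (by rw [← h2, ← h]; simp)
      obtain ⟨L, hp, hm⟩ := hlim _ h3
      rw [h2] at hp hm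
      refine ⟨L, ?_⟩
      rw [hAeq, nhdsWithin_union]
      exact hm.sup hp
  refine ⟨extendFrom A f, fun z hz => ?_, heq⟩
  have hpos : 0 < ‖z‖ := norm_pos_iff.2 hz
  have hball : Metric.ball z ‖z‖ ⊆ {0}ᶜ := by
    rintro w hw rfl
    simp at hw
  have h := differentiableOn_ball_of_off_real (hcont.mono hball) fun w _ him => by
    have hw := mem_cutPlane_of_im_ne_zero him
    refine (hf w hw).differentiableAt.congr_of_eventuallyEq ?_
    filter_upwards [isOpen_cutPlane.mem_nhds hw] with u hu
    exact heq hu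
  exact (h.differentiableAt (Metric.ball_mem_nhds z hpos)).differentiableWithinAt

/-- Along z = -e^u with u → -∞ the power is e^(β(u+πi)), and replacing u by u + s multiplies it by
e^(βs). A nonzero limit forces e^(βs) = 1 for all real s, hence β = 0. -/
lemma not_tendsto_cutPow {β : ℂ} (hβ : β ≠ 0) {c : ℂ} (hc : c ≠ 0) :
    ¬ Tendsto (cutPow β) (𝓝[cutPlane] 0) (𝓝 c) := by
  intro h
  have h1 : Tendsto (fun u : ℝ => -exp (u : ℂ)) atBot (𝓝[cutPlane] 0) := by
    refine tendsto_nhdsWithin_of_tendsto_nhds_of_eventually_within _ ?_ (.of_forall fun u => ?_)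
    · have h2 : Tendsto (fun u : ℝ => ((Real.exp u : ℝ) : ℂ)) atBot (𝓝 ((0 : ℝ) : ℂ)) :=
        (continuous_ofReal.tendsto 0).comp Real.tendsto_exp_atBot
      simpa using h2.neg
    · rw [mem_cutPlane_iff, neg_neg, ← ofReal_exp, ofReal_mem_slitPlane]
      exact Real.exp_pos u
  have hval : ∀ u : ℝ, cutPow β (-exp (u : ℂ)) = exp (β * (u + Real.pi * I)) := by
    intro u
    rw [cutPow, neg_neg, ← ofReal_exp, ← ofReal_log (Real.exp_pos u).le, Real.log_exp]
  have h2 := h.comp h1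
  have hs : ∀ s : ℝ, exp (β * s) = 1 := by
    intro s
    have h3 := h2.comp (tendsto_atBot_add_const_right atBot s tendsto_id)
    have h4 := h2.mul_const (exp (β * s))
    have h5 := tendsto_nhds_unique (h3.congr fun u => ?_) h4
    · exact mul_left_cancel₀ hc (by rw [← h5, mul_one])
    · simp only [Function.comp, id, hval]
      rw [← exp_add]
      push_cast
      ring_nf
  have h6 : HasDerivAt (fun s : ℝ => exp (β * s)) β 0 := by
    have h7 : HasDerivAt (fun s : ℂ => exp (β * s)) β ((0 : ℝ) : ℂ) := by
      simpa using ((hasDerivAt_id ((0 : ℝ) : ℂ)).const_mul β).cexp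
    exact h7.comp_ofReal
  simp only [hs] at h6
  exact hβ (h6.unique (hasDerivAt_const (0 : ℝ) (1 : ℂ)))

/-- The modulus of z^(N+α) is |z|^(N + Re α) e^(-Im α · arg z), where the argument stays in [0, 2π];
any N ≥ -Re α works. -/
lemma exists_pow_mul_cutPow_isBigO (α : ℂ) :
    ∃ N : ℕ, (fun z => z ^ N * cutPow α z) =O[𝓝[cutPlane] 0] (fun _ => (1 : ℂ)) := by
  obtain ⟨N, hN⟩ := exists_nat_ge (-α.re)
  refine ⟨N, Asymptotics.IsBigO.of_bound (Real.exp (|α.im| * (2 * Real.pi))) ?_⟩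
  filter_upwards [self_mem_nhdsWithin,
    mem_nhdsWithin_of_mem_nhds (Metric.closedBall_mem_nhds (0 : ℂ) one_pos)] with z hz hz1
  have hz0 := ne_zero_of_mem_cutPlane hz
  rw [mem_closedBall_zero_iff] at hz1
  rw [← cutPow_natCast N hz0, ← cutPow_add, cutPow, norm_exp, norm_one, mul_one, Real.exp_le_exp]
  have h1 : Real.log ‖z‖ ≤ 0 := Real.log_nonpos (norm_nonneg _) hz1
  have h2 := abs_arg_le_pi (-z)
  simp only [mul_re, add_re, natCast_re, log_re, norm_neg, ofReal_re, I_re, mul_zero, ofReal_im,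
    I_im, mul_one, sub_self, add_zero, add_im, natCast_im, zero_add, log_im, mul_im]
  have h3 : (N + α.re) * Real.log ‖z‖ ≤ 0 := mul_nonpos_of_nonneg_of_nonpos (by linarith) h1
  have h4 : -(α.im * (arg (-z) + Real.pi)) ≤ |α.im| * (2 * Real.pi) := by
    refine (neg_le_abs _).trans ?_
    rw [abs_mul]
    gcongr
    refine (abs_add_le _ _).trans ?_
    rw [abs_of_pos Real.pi_pos]
    linarith
  linarith

/-- A singularity at the origin of the type `z^α 𝒪₀ + O(1)` of a single-valued function is
removable. -/
lemma exists_extension_at_zero {α : ℂ} (hα : ∀ k : ℕ, α ≠ -(k : ℂ)) {g : ℂ → ℂ}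
    (hg : DifferentiableOn ℂ g {0}ᶜ) (hgerm : IsPowGermAddBounded α g) :
    ∃ F : ℂ → ℂ, Differentiable ℂ F ∧ Set.EqOn F g {0}ᶜ := by
  obtain ⟨f₀, hf₀, hO⟩ := hgerm
  have hdiff : ∀ᶠ z in 𝓝[≠] (0 : ℂ), DifferentiableAt ℂ g z := by
    filter_upwards [self_mem_nhdsWithin] with z hz
    exact (hg z hz).differentiableAt (isOpen_compl_singleton.mem_nhds hz)
  -- Moderate growth excludes an essential singularity: z^N g is bounded off the cut, hence by
  -- continuity in a punctured disk.
  have hmer : MeromorphicAt g 0 := by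
    obtain ⟨N, hN⟩ := exists_pow_mul_cutPow_isBigO α
    have hid : ∀ k : ℕ, (fun z : ℂ => z ^ k) =O[𝓝[cutPlane] 0] (fun _ => (1 : ℂ)) := fun k =>
      (((continuous_pow k).tendsto 0).mono_left nhdsWithin_le_nhds).isBigO_one ℂ
    have hf₀' : f₀ =O[𝓝[cutPlane] 0] (fun _ => (1 : ℂ)) :=
      (hf₀.continuousAt.tendsto.mono_left nhdsWithin_le_nhds).isBigO_one ℂ
    have h1 := ((hid N).mul hO).add (((hN.mul hf₀')).congr_right fun _ => by simp)
    have h2 : (fun z => z ^ N * g z) =O[𝓝[cutPlane] 0] (fun _ => (1 : ℂ)) := by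
      refine (h1.congr_left fun z => ?_).congr_right fun _ => by simp
      ring
    obtain ⟨C, hC⟩ := h2.bound
    rw [eventually_nhdsWithin_iff, Metric.eventually_nhds_iff_ball] at hC
    obtain ⟨ε, hε, hC⟩ := hC
    have h3 : ∀ z ∈ Metric.ball (0 : ℂ) ε \ {0}, ‖z ^ N * g z‖ ≤ C := by
      intro z hz
      refine le_of_le_on_cutPlane (u := fun z => ‖z ^ N * g z‖) (v := fun _ => C)
        (U := Metric.ball (0 : ℂ) ε \ {0}) (Metric.isOpen_ball.sdiff isClosed_singleton) ?_
        continuousOn_const (fun w hw hwU => by simpa using hC w hwU.1 hw) hz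
      exact ((continuous_pow N).continuousOn.mul (hg.continuousOn.mono fun w hw => hw.2)).norm
    -- One power more than needed for boundedness: the product then tends to 0, which is also its
    -- value at 0 whatever g is there.
    refine ⟨N + 1, ?_⟩
    refine analyticAt_of_differentiable_on_punctured_nhds_of_continuousAt ?_ ?_
    · filter_upwards [hdiff] with z hz
      simp only [sub_zero, smul_eq_mul]
      fun_prop
    · have h4 : Tendsto (fun z : ℂ => (z - 0) ^ (N + 1) • g z) (𝓝[≠] 0) (𝓝 0) := by
        have h5 : Tendsto (fun z : ℂ => ‖z‖ * C) (𝓝[≠] 0) (𝓝 0) := by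
          have h6 := (continuous_norm.tendsto (0 : ℂ)).mul_const C
          rw [norm_zero, zero_mul] at h6
          exact h6.mono_left nhdsWithin_le_nhds
        refine squeeze_zero_norm' ?_ h5
        filter_upwards [sdiff_mem_nhdsWithin_compl (Metric.ball_mem_nhds (0 : ℂ) hε) {0}] with z hz
        rw [sub_zero, smul_eq_mul, pow_succ', mul_assoc, norm_mul]
        gcongr
        exact h3 z hz
      rw [continuousAt_iff_punctured_nhds]
      simpa using h4
  have hord : 0 ≤ meromorphicOrderAt g 0 := by
    -- Suppose there is a pole of order j. Multiplication by z^j kills the bounded remainder, so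
    -- z^(α+j) f₀ has a nonzero limit. Hence f₀ is not locally zero, it behaves like z^l times a
    -- unit, and z^(α+j+l) has a nonzero limit, against `not_tendsto_cutPow`.
    by_contra! hneg
    obtain ⟨n, hn⟩ := WithTop.ne_top_iff_exists.1 hneg.ne_top
    obtain ⟨g₁, hg₁, hg₁0, hgeq⟩ := (meromorphicOrderAt_eq_int_iff hmer).1 hn.symm
    rw [← hn] at hneg
    have hn0 : n < 0 := by exact_mod_cast hneg
    obtain ⟨j, hj, hj0⟩ : ∃ j : ℕ, n = -(j : ℤ) ∧ j ≠ 0 := ⟨n.natAbs, by omega, by omega⟩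
    have hle : 𝓝[cutPlane] (0 : ℂ) ≤ 𝓝[≠] 0 :=
      nhdsWithin_mono _ fun z hz => ne_zero_of_mem_cutPlane hz
    have hle' : 𝓝[cutPlane] (0 : ℂ) ≤ 𝓝 0 := nhdsWithin_le_nhds
    have h1 : Tendsto (fun z => z ^ j * g z) (𝓝[cutPlane] 0) (𝓝 (g₁ 0)) := by
      refine (hg₁.continuousAt.tendsto.mono_left hle').congr' ?_
      filter_upwards [hle hgeq, self_mem_nhdsWithin] with z hz hzc
      have hz0 := pow_ne_zero j (ne_zero_of_mem_cutPlane hzc)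
      rw [hz, hj, sub_zero, zpow_neg, zpow_natCast, smul_eq_mul, mul_inv_cancel_left₀ hz0]
    have h2 : Tendsto (fun z : ℂ => z ^ j * (g z - cutPow α z * f₀ z)) (𝓝[cutPlane] 0) (𝓝 0) := by
      have h3 : Tendsto (fun z : ℂ => z ^ j) (𝓝[cutPlane] 0) (𝓝 0) := by
        have h4 := (continuous_pow (M := ℂ) j).tendsto 0
        rw [zero_pow hj0] at h4
        exact h4.mono_left hle'
      have h5 := (Asymptotics.isBigO_refl (fun z : ℂ => z ^ j) (𝓝[cutPlane] 0)).mul hO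
      simp only [mul_one] at h5
      exact h5.trans_tendsto h3
    have h3 : Tendsto (fun z => z ^ j * cutPow α z * f₀ z) (𝓝[cutPlane] 0) (𝓝 (g₁ 0)) := by
      have h4 := h1.sub h2
      rw [sub_zero] at h4
      refine h4.congr fun z => ?_
      ring
    have := neBot_nhdsWithin_cutPlane 0
    by_cases hzero : ∀ᶠ z in 𝓝 (0 : ℂ), f₀ z = 0
    · refine hg₁0 (tendsto_nhds_unique h3 (tendsto_const_nhds.congr' ?_))
      filter_upwards [hle' hzero] with z hz
      rw [hz, mul_zero]
    · obtain ⟨l, f₁, hf₁, hf₁0, hfeq⟩ :=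
        hf₀.exists_eventuallyEq_pow_smul_nonzero_iff.2 hzero
      have h4 := hf₁.continuousAt.tendsto.mono_left hle'
      have hα' : α + (j + l : ℕ) ≠ 0 := fun h => hα (j + l) (by linear_combination h)
      refine not_tendsto_cutPow hα' (div_ne_zero hg₁0 hf₁0) ((h3.div h4 hf₁0).congr' ?_)
      filter_upwards [hle' hfeq, self_mem_nhdsWithin, h4.eventually_ne hf₁0] with z hz hzc hz1
      rw [Pi.div_apply, hz, cutPow_add, cutPow_natCast _ (ne_zero_of_mem_cutPlane hzc), sub_zero,
        smul_eq_mul, pow_add]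
      field_simp
  obtain ⟨c, hc⟩ := tendsto_nhds_of_meromorphicOrderAt_nonneg hmer hord
  have heq : Set.EqOn (Function.update g 0 c) g {0}ᶜ := fun z hz => Function.update_of_ne hz _ _
  refine ⟨Function.update g 0 c, fun z => ?_, heq⟩
  have hoff : ∀ w ∈ ({0}ᶜ : Set ℂ), DifferentiableAt ℂ (Function.update g 0 c) w := fun w hw => by
    refine ((hg w hw).differentiableAt
      (isOpen_compl_singleton.mem_nhds hw)).congr_of_eventuallyEq ?_
    filter_upwards [isOpen_compl_singleton.mem_nhds hw] with u hu
    exact heq hu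
  by_cases hz : z = 0
  · rw [hz]
    refine (analyticAt_of_differentiable_on_punctured_nhds_of_continuousAt ?_
      (continuousAt_update_same.2 hc)).differentiableAt
    filter_upwards [self_mem_nhdsWithin] with w hw
    exact hoff w hw
  · exact hoff z hz

/-- A holomorphic function on the slit plane without jump across the cut and with a singularity of
the type `z^α 𝒪₀ + O(1)` at the origin is the restriction of an entire function. -/
lemma exists_entire_eqOn {α : ℂ} (hα : ∀ k : ℕ, α ≠ -(k : ℂ)) {f : ℂ → ℂ}
    (hf : AnalyticOnNhd ℂ f cutPlane)
    (hlim : ∀ x : ℝ, 0 < x → ∃ L : ℂ, Tendsto f (𝓝[{z | 0 < z.im}] (x : ℂ)) (𝓝 L) ∧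
      Tendsto f (𝓝[{z | z.im < 0}] (x : ℂ)) (𝓝 L))
    (hgerm : IsPowGermAddBounded α f) :
    ∃ F : ℂ → ℂ, Differentiable ℂ F ∧ Set.EqOn F f cutPlane := by
  obtain ⟨g, hg, hgf⟩ := exists_extension_across_cut hf hlim
  obtain ⟨F, hF, hFg⟩ := exists_extension_at_zero hα hg (by
    obtain ⟨f₀, hf₀, hO⟩ := hgerm
    refine ⟨f₀, hf₀, hO.congr' ?_ EventuallyEq.rfl⟩
    filter_upwards [self_mem_nhdsWithin] with z hz
    rw [hgf hz])
  exact ⟨F, hF, fun z hz => (hFg (ne_zero_of_mem_cutPlane hz)).trans (hgf hz)⟩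

lemma eq_of_isBigO_cutInfty {F : ℂ → ℂ} (hF : Differentiable ℂ F) {c : ℂ}
    (h : (fun z => F z - c) =O[cutInfty] (fun z => z⁻¹)) (z : ℂ) : F z = c := by
  obtain ⟨C, hC⟩ := h.bound
  rw [eventually_inf_principal] at hC
  obtain ⟨R, hR⟩ : ∃ R : ℝ, ∀ z : ℂ, R < ‖z‖ → z ∈ cutPlane → ‖F z - c‖ ≤ C * ‖z⁻¹‖ := by
    rw [← comap_norm_atTop, eventually_comap] at hC
    obtain ⟨R, hR⟩ := eventually_atTop.1 hC
    exact ⟨R, fun z hz => hR ‖z‖ hz.le z rfl⟩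
  have h1 : ∀ z : ℂ, max R 0 < ‖z‖ → ‖F z - c‖ ≤ C * ‖z⁻¹‖ := by
    intro z hz
    refine le_of_le_on_cutPlane (u := fun z => ‖F z - c‖) (v := fun z => C * ‖z⁻¹‖)
      (U := {z | max R 0 < ‖z‖}) (isOpen_lt continuous_const continuous_norm)
      (hF.continuous.sub continuous_const).norm.continuousOn ?_
      (fun w hw hwU => hR w ((le_max_left _ _).trans_lt hwU) hw) hz
    refine continuousOn_const.mul (ContinuousOn.norm (ContinuousOn.inv₀ continuousOn_id ?_))
    intro w hw
    exact norm_pos_iff.1 ((le_max_right R 0).trans_lt hw)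
  refine hF.apply_eq_of_tendsto_cocompact z ?_
  rw [← Metric.cobounded_eq_cocompact, tendsto_iff_norm_sub_tendsto_zero]
  have h2 : Tendsto (fun z : ℂ => C * ‖z⁻¹‖) (Bornology.cobounded ℂ) (𝓝 0) := by
    have h3 := (tendsto_inv₀_cobounded (α := ℂ)).norm.const_mul C
    rwa [norm_zero, mul_zero] at h3
  refine squeeze_zero' (.of_forall fun _ => norm_nonneg _) ?_ h2
  filter_upwards [tendsto_norm_cobounded_atTop.eventually_gt_atTop (max R 0)] with z hz
  exact h1 z hz

/-! ### Existence -/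

lemma tendsto_eval_nhdsWithin (p : ℂ[X]) (x : ℂ) (s : Set ℂ) :
    Tendsto (fun z => p.eval z) (𝓝[s] x) (𝓝 (p.eval x)) :=
  (p.continuous.tendsto x).mono_left nhdsWithin_le_nhds

lemma tendsto_matrix_two {l : Filter ℂ} {f : ℂ → Matrix (Fin 2) (Fin 2) ℂ}
    {M : Matrix (Fin 2) (Fin 2) ℂ} (h : ∀ i j, Tendsto (fun z => f z i j) l (𝓝 (M i j))) :
    Tendsto f l (𝓝 M) :=
  tendsto_pi_nhds.2 fun i => tendsto_pi_nhds.2 fun j => h i j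

theorem isSolution_solution {α : ℂ} (hα : ∀ k : ℕ, α ≠ -(k : ℂ)) {n : ℕ} (hn : 1 ≤ n) :
    IsSolution α n (solution α n) := by
  have hβ : ∀ k : ℕ, α ≠ -((k : ℂ) + 1) := fun k h => hα (k + 1) (by push_cast; exact h)
  obtain ⟨m, rfl⟩ : ∃ m, n = m + 1 := ⟨n - 1, by omega⟩
  set c := coeffC α (m + 1) with hc
  set p := monicLaguerre α (m + 1) with hp
  set q := monicLaguerre α m with hq
  have h00 : ∀ z, solution α (m + 1) z 0 0 = p.eval z := fun z => rfl
  have h01 : ∀ z, solution α (m + 1) z 0 1 = cauchyTransform α p z := fun z => rfl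
  have h10 : ∀ z, solution α (m + 1) z 1 0 = c * q.eval z := fun z => rfl
  have h11 : ∀ z, solution α (m + 1) z 1 1 = c * cauchyTransform α q z := fun z => rfl
  refine ⟨?_, ?_, ?_, ?_, ?_⟩
  · rw [Fin.forall_fin_two, Fin.forall_fin_two, Fin.forall_fin_two]
    simp only [h00, h01, h10, h11]
    exact ⟨⟨analyticOnNhd_eval p _, analyticOnNhd_cauchyTransform hβ p⟩,
      analyticOnNhd_const.mul (analyticOnNhd_eval q _),
      analyticOnNhd_const.mul (analyticOnNhd_cauchyTransform hβ q)⟩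
  · choose! Pp Pm hPp hPm hP using fun x hx => exists_tendsto_cauchyTransform hβ p (x := x) hx
    choose! Qp Qm hQp hQm hQ using fun x hx => exists_tendsto_cauchyTransform hβ q (x := x) hx
    refine ⟨fun x => !![p.eval (x : ℂ), Pp x; c * q.eval (x : ℂ), c * Qp x],
      fun x => !![p.eval (x : ℂ), Pm x; c * q.eval (x : ℂ), c * Qm x], fun x hx => ⟨?_, ?_, ?_⟩⟩
    · refine tendsto_matrix_two ?_
      rw [Fin.forall_fin_two, Fin.forall_fin_two, Fin.forall_fin_two]
      simp only [h00, h01, h10, h11]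
      exact ⟨⟨tendsto_eval_nhdsWithin _ _ _, hPp x hx⟩,
        (tendsto_eval_nhdsWithin _ _ _).const_mul c, (hQp x hx).const_mul c⟩
    · refine tendsto_matrix_two ?_
      rw [Fin.forall_fin_two, Fin.forall_fin_two, Fin.forall_fin_two]
      simp only [h00, h01, h10, h11]
      exact ⟨⟨tendsto_eval_nhdsWithin _ _ _, hPm x hx⟩,
        (tendsto_eval_nhdsWithin _ _ _).const_mul c, (hQm x hx).const_mul c⟩
    · beta_reduce
      rw [hP x hx, hQ x hx]
      ext i j
      fin_cases i <;> fin_cases j <;> simp [Matrix.mul_apply] <;> ring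
  -- This is Y diag(z⁻ⁿ, zⁿ) - I with n = m + 1.
  · refine ⟨fun z => !![p.eval z * (z ^ (m + 1))⁻¹ - 1, z ^ (m + 1) * cauchyTransform α p z;
      c * (q.eval z * (z ^ (m + 1))⁻¹), c * (z ^ (m + 1) * cauchyTransform α q z) - 1], ?_, ?_⟩
    · rw [Fin.forall_fin_two, Fin.forall_fin_two, Fin.forall_fin_two]
      refine ⟨⟨isBigO_eval_mul_inv_pow_sub_one (natDegree_monicLaguerre_le α _)
        (coeff_monicLaguerre_self α _), ?_⟩, ?_, ?_⟩
      · refine (isBigO_cauchyTransform hβ (X ^ (m + 1) * p)).congr' ?_ EventuallyEq.rfl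
        filter_upwards [eventually_mem_cutInfty] with z hz
        exact (pow_mul_cauchyTransform hβ (fun j hj => moment_monicLaguerre_of_lt hβ hj) hz).symm
      · exact (isBigO_eval_mul_inv_pow
          (Nat.lt_succ_of_le (natDegree_monicLaguerre_le α m))).const_mul_left c
      · refine ((isBigO_cauchyTransform hβ (X * (X ^ m * q))).const_mul_left c).congr' ?_
          EventuallyEq.rfl
        filter_upwards [eventually_mem_cutInfty] with z hz
        have h1 := pow_mul_cauchyTransform hβ
          (fun j hj => moment_monicLaguerre_of_lt (m := m) hβ hj) hz
        have h2 := mul_cauchyTransform hβ (X ^ m * q) hz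
        rw [moment_monicLaguerre_self hβ] at h2
        -- π_m is orthogonal only up to degree m - 1, so moving the last factor z inside leaves the
        -- moment m! Γ(α+m+1); c is chosen to turn that term into the diagonal entry 1.
        have h3 : c * ((2 * Real.pi * I)⁻¹ * ((m.factorial : ℂ) * Gamma (α + m + 1))) = -1 := by
          have hG : Gamma (α + m + 1) ≠ 0 := Complex.Gamma_ne_zero fun k h =>
            hα (k + m + 1) (by push_cast; linear_combination h)
          have hf : (m.factorial : ℂ) ≠ 0 := by exact_mod_cast m.factorial_ne_zero
          have hpi : (Real.pi : ℂ) ≠ 0 := by exact_mod_cast Real.pi_ne_zero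
          rw [hc, coeffC, Nat.add_sub_cancel]
          push_cast
          rw [← add_assoc]
          field_simp
        change _ = c * (z ^ (m + 1) * cauchyTransform α q z) - 1
        rw [pow_succ', mul_assoc, h1, h2, mul_sub, h3]
        ring
    · filter_upwards [eventually_mem_cutInfty] with z hz
      have hz0 := ne_zero_of_mem_cutPlane hz
      ext i j
      fin_cases i <;> fin_cases j <;> simp [Matrix.mul_apply, h00, h01, h10, h11] <;> field_simp
  · rw [Fin.forall_fin_two]
    simp only [h00, h10]
    exact ⟨(tendsto_eval_nhdsWithin p 0 _).isBigO_one ℂ,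
      ((tendsto_eval_nhdsWithin q 0 _).const_mul c).isBigO_one ℂ⟩
  · rw [Fin.forall_fin_two]
    simp only [h01, h11]
    exact ⟨isPowGermAddBounded_cauchyTransform hα p,
      (isPowGermAddBounded_cauchyTransform hα q).mul_left (a := fun _ => c) analyticAt_const⟩

/-! ### Uniqueness -/

/-- The jump matrix fixes the first column, and boundedness at 0 is the singularity type with zero
germ. -/
lemma IsSolution.exists_entire_left {α : ℂ} (hα : ∀ k : ℕ, α ≠ -(k : ℂ)) {n : ℕ}
    {Y : ℂ → Matrix (Fin 2) (Fin 2) ℂ} (hY : IsSolution α n Y) (i : Fin 2) :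
    ∃ F : ℂ → ℂ, Differentiable ℂ F ∧ Set.EqOn F (fun z => Y z i 0) cutPlane := by
  obtain ⟨Yp, Ym, hj⟩ := hY.jump
  refine exists_entire_eqOn hα (hY.analytic i 0) (fun x hx => ?_) (.of_isBigO (hY.zero_left i))
  obtain ⟨h1, h2, h3⟩ := hj x hx
  have h4 : Yp x i 0 = Ym x i 0 := by
    rw [h3]
    simp [Matrix.mul_apply]
  have e1 := (tendsto_pi_nhds.1 (tendsto_pi_nhds.1 h1 i)) 0
  rw [h4] at e1
  exact ⟨_, e1, (tendsto_pi_nhds.1 (tendsto_pi_nhds.1 h2 i)) 0⟩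

/-- The entries of `Y S⁻¹`, up to order and sign, are constant. -/
lemma IsSolution.mul_sub_mul_eq {α : ℂ} (hα : ∀ k : ℕ, α ≠ -(k : ℂ)) {n : ℕ}
    {Y S : ℂ → Matrix (Fin 2) (Fin 2) ℂ} (hY : IsSolution α n Y) (hS : IsSolution α n S)
    (i k : Fin 2) {z : ℂ} (hz : z ∈ cutPlane) :
    Y z i 0 * S z k 1 - Y z i 1 * S z k 0 =
      (1 : Matrix (Fin 2) (Fin 2) ℂ) i 0 * (1 : Matrix (Fin 2) (Fin 2) ℂ) k 1 -
      (1 : Matrix (Fin 2) (Fin 2) ℂ) i 1 * (1 : Matrix (Fin 2) (Fin 2) ℂ) k 0 := by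
  obtain ⟨a, ha, hae⟩ := hY.exists_entire_left hα i
  obtain ⟨b, hb, hbe⟩ := hS.exists_entire_left hα k
  obtain ⟨F, hF, hFe⟩ := exists_entire_eqOn hα
    (f := fun z => Y z i 0 * S z k 1 - Y z i 1 * S z k 0)
    (((hY.analytic i 0).mul (hS.analytic k 1)).sub ((hY.analytic i 1).mul (hS.analytic k 0)))
    (by
      intro x hx
      obtain ⟨Yp, Ym, hj⟩ := hY.jump
      obtain ⟨Sp, Sm, hj'⟩ := hS.jump
      obtain ⟨h1, h2, h3⟩ := hj x hx
      obtain ⟨h1', h2', h3'⟩ := hj' x hx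
      have e : ∀ {l : Filter ℂ} {T : ℂ → Matrix (Fin 2) (Fin 2) ℂ} {M : Matrix (Fin 2) (Fin 2) ℂ},
          Tendsto T l (𝓝 M) → ∀ i j, Tendsto (fun z => T z i j) l (𝓝 (M i j)) :=
        fun h i j => tendsto_pi_nhds.1 (tendsto_pi_nhds.1 h i) j
      have hp := ((e h1 i 0).mul (e h1' k 1)).sub ((e h1 i 1).mul (e h1' k 0))
      have hm := ((e h2 i 0).mul (e h2' k 1)).sub ((e h2 i 1).mul (e h2' k 0))
      -- A row of Y and a row of S are multiplied by the same jump matrix, of determinant 1, so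
      -- their minor is unchanged.
      have heq : Yp x i 0 * Sp x k 1 - Yp x i 1 * Sp x k 0 =
          Ym x i 0 * Sm x k 1 - Ym x i 1 * Sm x k 0 := by
        rw [h3, h3']
        simp [Matrix.mul_apply]
        ring
      rw [heq] at hp
      exact ⟨_, hp, hm⟩)
    (by
      -- Each product pairs a second-column entry with an entire first-column entry, so z^α never
      -- meets another z^α.
      obtain ⟨f₀, hf₀, hO⟩ := ((hS.zero_right k).mul_left (ha.analyticAt 0)).add
        ((hY.zero_right i).mul_left (hb.neg.analyticAt 0))
      refine ⟨f₀, hf₀, hO.congr' ?_ EventuallyEq.rfl⟩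
      filter_upwards [self_mem_nhdsWithin] with w hw
      rw [Pi.neg_apply, hae hw, hbe hw]
      ring)
  refine (hFe hz).symm.trans (eq_of_isBigO_cutInfty hF ?_ z)
  obtain ⟨E, hE, hYE⟩ := hY.infty
  obtain ⟨E', hE', hSE⟩ := hS.infty
  have hI : ∀ (A : Matrix (Fin 2) (Fin 2) ℂ) (i j : Fin 2),
      (fun _ : ℂ => A i j) =O[cutInfty] (fun _ => (1 : ℂ)) := fun A i j =>
    Asymptotics.isBigO_const_const _ one_ne_zero _
  have hprod : ∀ i j k l, (fun z => (1 + E z) i j * (1 + E' z) k l -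
      (1 : Matrix (Fin 2) (Fin 2) ℂ) i j * (1 : Matrix (Fin 2) (Fin 2) ℂ) k l)
        =O[cutInfty] (fun z => z⁻¹) := by
    intro i j k l
    have h1 := (((hI 1 i j).mul (hE' k l)).congr_right fun z => one_mul z⁻¹).add
      (((hI 1 k l).mul (hE i j)).congr_right fun z => one_mul z⁻¹)
    have h2 := ((hE i j).mul ((hE' k l).trans isBigO_inv_one)).congr_right fun z => mul_one z⁻¹
    refine (h1.add h2).congr_left fun z => ?_
    simp only [Matrix.add_apply]
    ring
  -- The same pairing cancels zⁿ against z⁻ⁿ, leaving only entries of I + O(1/z).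
  refine ((hprod i 0 k 1).sub (hprod i 1 k 0)).congr' ?_ EventuallyEq.rfl
  filter_upwards [hYE, hSE, eventually_mem_cutInfty] with w h1 h2 hw
  have hw0 := pow_ne_zero n (ne_zero_of_mem_cutPlane hw)
  have hcol : ∀ (A : Matrix (Fin 2) (Fin 2) ℂ) (i : Fin 2),
      (A * !![w ^ n, 0; 0, (w ^ n)⁻¹]) i 0 = A i 0 * w ^ n ∧
      (A * !![w ^ n, 0; 0, (w ^ n)⁻¹]) i 1 = A i 1 * (w ^ n)⁻¹ := fun A i => by
    constructor <;> simp [Matrix.mul_apply]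
  have hFw : F w = Y w i 0 * S w k 1 - Y w i 1 * S w k 0 := hFe hw
  simp only [hFw, h1, h2, (hcol _ _).1, (hcol _ _).2]
  field_simp
  ring

theorem IsSolution.eqOn {α : ℂ} (hα : ∀ k : ℕ, α ≠ -(k : ℂ)) {n : ℕ}
    {Y S : ℂ → Matrix (Fin 2) (Fin 2) ℂ} (hY : IsSolution α n Y) (hS : IsSolution α n S) :
    Set.EqOn Y S cutPlane := by
  intro z hz
  -- Comparing S with itself gives det S = 1; the four minors of Y against S then determine Y by
  -- Cramer's rule.
  have hd := hS.mul_sub_mul_eq hα hS 0 1 hz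
  have h := fun i k => hY.mul_sub_mul_eq hα hS i k hz
  have h00 := h 0 0
  have h01 := h 0 1
  have h10 := h 1 0
  have h11 := h 1 1
  simp only [Matrix.one_apply_eq, Matrix.one_apply_ne, ne_eq, zero_ne_one, one_ne_zero,
    not_false_eq_true, mul_one, mul_zero, sub_zero, zero_sub, sub_self] at hd h00 h01 h10 h11
  ext i j
  fin_cases i <;> fin_cases j <;> simp only [Fin.zero_eta, Fin.mk_one]
  · linear_combination -Y z 0 0 * hd + S z 0 0 * h01 - S z 1 0 * h00
  · linear_combination -Y z 0 1 * hd + S z 0 1 * h01 - S z 1 1 * h00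
  · linear_combination -Y z 1 0 * hd + S z 0 0 * h11 - S z 1 0 * h10
  · linear_combination -Y z 1 1 * hd + S z 0 1 * h11 - S z 1 1 * h10

end LaguerreRH

end

theorem theorem3p3 (α : ℂ) (hα : ∀ k : ℕ, α ≠ -(k : ℂ)) (n : ℕ) (hn : 1 ≤ n) :
    LaguerreRH.IsSolution α n (LaguerreRH.solution α n) ∧
    ∀ Y : ℂ → Matrix (Fin 2) (Fin 2) ℂ, LaguerreRH.IsSolution α n Y →
      Set.EqOn Y (LaguerreRH.solution α n) LaguerreRH.cutPlane :=
  ⟨LaguerreRH.isSolution_solution hα hn, fun _ hY =>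
    hY.eqOn hα (LaguerreRH.isSolution_solution hα hn)⟩
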